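/- Fix an integer $K\ge 0$ and a probability space. For every $M\ge 1$ let $(H_k)_{k\in\mathbb Z}=(H_k^{(M)})_{k\in\mathbb Z}$ be a family of complex $M\times K$ matrices, and put $H(\nu)=\sum_{k\in\mathbb Z}H_k e^{-2i\pi\nu k}$. Assume, $\|\cdot\|_2$ being the spectral norm of a matrix and the Euclidean norm of a vector, that $$\sup_{M\ge1}\sum_{k\in\mathbb Z}(1+|k|)\,\|H_k\|_2<\infty ,\qquad \lim_{M\to\infty}\max_{1\le m\le M}\max_{\nu\in[0,1]}\|h^m(\nu)\|_2=0 ,$$ where $h^1(\nu),\dots,h^M(\nu)$ are the rows of $H(\nu)$. For every $M\ge 1$ let $(\epsilon_n)_{n\in\mathbb Z}=(\epsilon^{(M)}_n)_{n\in\mathbb Z}$ be a $K$-dimensional standard complex Gaussian white noise (independent $\mathcal N_{\mathbb C^K}(0,I_K)$ circular vectors; the noise may be the same for all $M$, and nothing is assumed on the joint law for different $M$), and let the $M$-dimensional signal $u_n=u_n^{(M)}$ satisfy $u_n=\sum_{k\in\mathbb Z}H_k\epsilon_{n-k}$ with probability one, for every $n\in\mathbb Z$. Let $N=N(M)$ and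 $B=B(M)$ be non-negative integers, $B$ even, such that, as $M\to\infty$, $M=O(N^\alpha)$ for some $\alpha\in(0,1)$, $M/B\to c$ for some $c\in(0,1)$, and $\log N=o(M)$. Put $$\xi_u(\nu)=\frac1{\sqrt N}\sum_{n=0}^{N-1}u_n e^{-2i\pi n\nu},\qquad \hat S_u(\nu)=\frac1{B+1}\sum_{b=-B/2}^{B/2}\xi_u\!\left(\nu+\tfrac bN\right)\xi_u\!\left(\nu+\tfrac bN\right)^* ,$$ and $\mathcal V_N=\{k/N:k=0,\dots,N-1\}$. Then for every $M\ge1$ the process $(u_n)_{n\in\mathbb Z}$ has mean zero, its autocovariance $R_u(\ell)=\mathbb E[u_nu_{n-\ell}^*]$ exists and does not depend on $n$, and its spectral density is $S_u(\nu)=\sum_{\ell\in\mathbb Z}R_u(\ell)e^{-2i\pi\nu\ell}=H(\nu)H(\nu)^*$, a matrix of rank at most $K$, for every real $\nu$; and $$\max_{\nu\in\mathcal V_N}\left\|\hat S_u(\nu)-H(\nu)H(\nu)^*\right\|_2\longrightarrow 0\quad\text{almost surely as } M\to\infty .$$ -/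

import Mathlib

open MeasureTheory ProbabilityTheory Filter Topology Asymptotics
open scoped Matrix Matrix.Norms.L2Operator

/-- The standard circular complex Gaussian law `N_ℂ(0, 1)` : the law of `X + i Y` with `X`, `Y`
independent real centred Gaussian variables of variance `1/2`. -/
noncomputable def stdComplexGaussian : Measure ℂ :=
  ((gaussianReal 0 (1 / 2)).prod (gaussianReal 0 (1 / 2))).map
    (fun p : ℝ × ℝ => (p.1 : ℂ) + (p.2 : ℂ) * Complex.I)

/-- A `K`-dimensional standard complex Gaussian white noise indexed by `ℤ` : all the scalar
variables `ε_{n,i}` are independent with law `N_ℂ(0, 1)`; equivalently, the vectors `ε_n` are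
independent with law `N_{ℂ^K}(0, I_K)`. -/
structure IsComplexGaussianWhiteNoise {Ω : Type*} [MeasurableSpace Ω] {K : ℕ}
    (ε : ℤ → Ω → Fin K → ℂ) (μ : Measure Ω) : Prop where
  law : ∀ n i, HasLaw (fun ω => ε n ω i) stdComplexGaussian μ
  indep : iIndepFun (fun (p : ℤ × Fin K) (ω : Ω) => ε p.1 ω p.2) μ

/-- The process `u` is the output of the filter `(H_k)` driven by `ε` : almost surely,
`u_n = ∑_{k ∈ ℤ} H_k ε_{n-k}`. -/
def IsFilterOutput {Ω : Type*} [MeasurableSpace Ω] {M K : ℕ}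
    (H : ℤ → Matrix (Fin M) (Fin K) ℂ) (ε : ℤ → Ω → Fin K → ℂ)
    (u : ℤ → Ω → Fin M → ℂ) (μ : Measure Ω) : Prop :=
  ∀ n : ℤ, ∀ᵐ ω ∂μ, HasSum (fun k : ℤ => H k *ᵥ ε (n - k) ω) (u n ω)

/-- The transfer function `H(ν) = ∑_{k ∈ ℤ} H_k e^{-2iπνk}` of a filter. -/
noncomputable def transferFunction {M K : ℕ} (H : ℤ → Matrix (Fin M) (Fin K) ℂ) (ν : ℝ) :
    Matrix (Fin M) (Fin K) ℂ :=
  ∑' k : ℤ, Complex.exp (-(2 * (Real.pi : ℂ) * Complex.I * (ν : ℂ) * (k : ℂ))) • H k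

/-- The assumptions on the family of filters `H M : ℤ → ℂ^{M × K}`, `M ≥ 1`; the norm of a matrix
is the spectral norm. -/
structure FilterAssumption {K : ℕ} (H : (M : ℕ) → ℤ → Matrix (Fin M) (Fin K) ℂ) : Prop where
  /-- `sup_{M ≥ 1} ∑_k (1 + |k|) ‖H_k‖₂ < ∞`. -/
  memory : ∃ C : ℝ, ∀ M : ℕ, 1 ≤ M →
    Summable (fun k : ℤ => (1 + |(k : ℝ)|) * ‖H M k‖) ∧
      ∑' k : ℤ, (1 + |(k : ℝ)|) * ‖H M k‖ ≤ C
  /-- The maximum over `m` and `ν ∈ [0, 1]` of the Euclidean norm of the `m`-th row of `H(ν)`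
  tends to zero. -/
  power : Tendsto (fun M : ℕ => ⨆ (m : Fin M) (ν : Set.Icc (0 : ℝ) 1),
    ‖WithLp.toLp 2 (transferFunction (H M) (ν : ℝ) m)‖) atTop (𝓝 0)

/-- The high-dimensional regime for the sample size `N = N(M)` and the (even) smoothing span
`B = B(M)`. -/
structure HighDimRegime (N B : ℕ → ℕ) : Prop where
  even_span : ∀ M, 1 ≤ M → Even (B M)
  /-- `M = O(N^α)` for some `α ∈ (0, 1)`. -/
  dim_isBigO : ∃ α ∈ Set.Ioo (0 : ℝ) 1,
    (fun M : ℕ => (M : ℝ)) =O[atTop] (fun M : ℕ => (N M : ℝ) ^ α)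
  /-- `M / B → c` for some `c ∈ (0, 1)`. -/
  ratio : ∃ c ∈ Set.Ioo (0 : ℝ) 1,
    Tendsto (fun M : ℕ => (M : ℝ) / (B M : ℝ)) atTop (𝓝 c)
  /-- The sample size is subexponential in the dimension : `log N = o(M)`. -/
  log_isLittleO : (fun M : ℕ => Real.log (N M : ℝ)) =o[atTop] (fun M : ℕ => (M : ℝ))

/-- The normalized finite Fourier transform
`ξ_x(ν) = N^{-1/2} ∑_{n=0}^{N-1} x_n e^{-2iπnν}` of a sequence `x` of vectors. -/
noncomputable def finiteFourier {d : ℕ} (N : ℕ) (x : ℤ → Fin d → ℂ) (ν : ℝ) : Fin d → ℂ :=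
  (1 / (Real.sqrt (N : ℝ) : ℂ)) •
    ∑ n ∈ Finset.range N,
      Complex.exp (-(2 * (Real.pi : ℂ) * Complex.I * (n : ℂ) * (ν : ℂ))) • x (n : ℤ)

/-- The frequency-smoothed periodogram
`Ŝ_x(ν) = (B+1)⁻¹ ∑_{b=-B/2}^{B/2} ξ_x(ν + b/N) ξ_x(ν + b/N)^*` with even smoothing span `B`. -/
noncomputable def smoothedPeriodogram {d : ℕ} (N B : ℕ) (x : ℤ → Fin d → ℂ) (ν : ℝ) :
    Matrix (Fin d) (Fin d) ℂ :=
  (1 / ((B : ℂ) + 1)) •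
    ∑ b ∈ Finset.Icc (-((B : ℤ) / 2)) ((B : ℤ) / 2),
      Matrix.vecMulVec (finiteFourier N x (ν + (b : ℝ) / (N : ℝ)))
        (star (finiteFourier N x (ν + (b : ℝ) / (N : ℝ))))

/-- `S` is the spectral density of the zero-mean, second-order stationary process `u` : the
autocovariance matrices `R(ℓ) = E[u_n u_{n-ℓ}^*]` exist and do not depend on `n`, and
`S(ν) = ∑_{ℓ ∈ ℤ} R(ℓ) e^{-2iπνℓ}` for every `ν`. -/
def HasSpectralDensity {Ω : Type*} [MeasurableSpace Ω] {M : ℕ}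
    (u : ℤ → Ω → Fin M → ℂ) (S : ℝ → Matrix (Fin M) (Fin M) ℂ) (μ : Measure Ω) : Prop :=
  (∀ n i, Integrable (fun ω => u n ω i) μ ∧ ∫ ω, u n ω i ∂μ = 0) ∧
  ∃ R : ℤ → Matrix (Fin M) (Fin M) ℂ,
    (∀ n ℓ i j,
      Integrable (fun ω => u n ω i * star (u (n - ℓ) ω j)) μ ∧
        ∫ ω, u n ω i * star (u (n - ℓ) ω j) ∂μ = R ℓ i j) ∧
    ∀ ν : ℝ, HasSum (fun ℓ : ℤ =>
      Complex.exp (-(2 * (Real.pi : ℂ) * Complex.I * (ν : ℂ) * (ℓ : ℂ))) • R ℓ) (S ν)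

/-!
For `|b| ≤ B/2` and `B < N` the finite Fourier transforms `ξ_ε(ν + b/N)` of the noise are i.i.d.
with law `N_ℂ(0, I_K)`, because the characters of frequencies `b/N` are orthogonal on
`{0, …, N - 1}` and uncorrelated jointly Gaussian variables are independent. Hence, for a unit
vector `v`, the quadratic form `v^* Ŝ_ε(ν) v` is a normalised chi-square variable with `2(B + 1)`
degrees of freedom and the Chernoff bound makes its deviation from `1` exponentially small in `B`.
As `log N = o(B)`, a union bound over the `N` frequencies, the Borel–Cantelli lemma and
polarization give `Ŝ_ε → I_K` almost surely, uniformly over the frequencies.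

Filtering almost commutes with the finite Fourier transform: in `ξ_u(ν) - H(ν) ξ_ε(ν)` the
coefficient `H_k` only meets the at most `2|k|` samples by which the windows `{0, …, N - 1}` and
`{-k, …, N - 1 - k}` differ. This difference is therefore `O(N^{-1/2})` in `L²`, uniformly in `ν`,
and it vanishes almost surely since `∑ 1/N < ∞`. Finally `H` is Lipschitz, so that `H(ν + b/N)` may
be replaced by `H(ν)` at the cost `O(B/N)`, and `Ŝ_u(ν)` is close to
`H(ν) Ŝ_ε(ν) H(ν)^*`, hence to `H(ν) H(ν)^*`.
-/

section ChiSquare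

theorem exp_neg_add_le_one_sub {t : ℝ} (ht : t ≤ 1 / 2) :
    Real.exp (-(t + 2 * t ^ 2)) ≤ 1 - t := by
  have hpos : 0 < 1 - t := by linarith
  rw [← Real.le_log_iff_exp_le hpos]
  refine le_trans ?_ (Real.one_sub_inv_le_log_of_pos hpos)
  have hquad : t ^ 2 / (1 - t) ≤ 2 * t ^ 2 := by
    rw [div_le_iff₀ hpos]
    nlinarith [sq_nonneg t]
  calc -(t + 2 * t ^ 2) ≤ -(t + t ^ 2 / (1 - t)) := by linarith
    _ = 1 - (1 - t)⁻¹ := by field_simp; ring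

theorem integral_exp_mul_sq_gaussianReal {v : NNReal} (hv : v ≠ 0) {t : ℝ} (ht : 2 * v * t < 1) :
    ∫ x, Real.exp (t * x ^ 2) ∂(gaussianReal 0 v) = (√(1 - 2 * v * t))⁻¹ := by
  have : (0 : ℝ) < v := by positivity
  have hpos : 0 < 1 - 2 * v * t := by linarith
  have hdensity (x : ℝ) : gaussianPDFReal 0 v x • Real.exp (t * x ^ 2)
      = (√(2 * Real.pi * v))⁻¹ * Real.exp (-((1 - 2 * v * t) / (2 * v)) * x ^ 2) := by
    rw [gaussianPDFReal, smul_eq_mul, mul_assoc, ← Real.exp_add]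
    congr 2
    field_simp
    ring
  rw [integral_gaussianReal_eq_integral_smul hv]
  simp_rw [hdensity]
  rw [integral_const_mul, integral_gaussian, ← Real.sqrt_inv, ← Real.sqrt_inv,
    ← Real.sqrt_mul (by positivity)]
  congr 1
  field_simp

theorem integrable_exp_mul_sq_gaussianReal {v : NNReal} (hv : v ≠ 0) {t : ℝ}
    (ht : 2 * v * t < 1) : Integrable (fun x => Real.exp (t * x ^ 2)) (gaussianReal 0 v) := by
  refine .of_integral_ne_zero ?_
  rw [integral_exp_mul_sq_gaussianReal hv ht]
  exact (inv_pos.2 (Real.sqrt_pos.2 (by linarith))).ne'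

variable {Ω : Type*} [MeasurableSpace Ω] {μ : Measure Ω} {v : NNReal}

theorem integrable_exp_mul_sq_of_hasLaw {Y : Ω → ℝ} (hv : v ≠ 0)
    (hY : HasLaw Y (gaussianReal 0 v) μ) {t : ℝ} (ht : 2 * v * t < 1) :
    Integrable (fun ω => Real.exp (t * Y ω ^ 2)) μ := by
  have hint := integrable_exp_mul_sq_gaussianReal hv ht
  rw [← hY.map_eq] at hint
  exact hint.comp_aemeasurable hY.aemeasurable

theorem mgf_sq_le {Y : Ω → ℝ} (hv : v ≠ 0) (hY : HasLaw Y (gaussianReal 0 v) μ) {t : ℝ}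
    (ht : 2 * v * t ≤ 1 / 2) :
    mgf (fun ω => Y ω ^ 2) μ t ≤ Real.exp ((2 * v * t + 2 * (2 * v * t) ^ 2) / 2) := by
  have hmgf : mgf (fun ω => Y ω ^ 2) μ t = (√(1 - 2 * v * t))⁻¹ := by
    rw [← integral_exp_mul_sq_gaussianReal hv (by linarith), mgf]
    exact hY.integral_comp (f := fun x => Real.exp (t * x ^ 2)) (by fun_prop)
  set s := 2 * v * t
  rw [hmgf, show (s + 2 * s ^ 2) / 2 = -(-(s + 2 * s ^ 2) / 2) by ring, Real.exp_neg,
    Real.exp_half]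
  gcongr
  exact exp_neg_add_le_one_sub ht

variable {κ : Type*} [Fintype κ] {Y : κ → Ω → ℝ}

theorem mgf_sum_sq_eq_prod (hY : ∀ i, AEMeasurable (Y i) μ) (hind : iIndepFun Y μ) (t : ℝ) :
    mgf (fun ω => ∑ i, Y i ω ^ 2) μ t = ∏ i, mgf (fun ω => Y i ω ^ 2) μ t := by
  have hsq : iIndepFun (fun i ω => Y i ω ^ 2) μ :=
    hind.comp (fun _ x => x ^ 2) (fun _ => by fun_prop)
  rw [← hsq.mgf_sum₀ fun i => (hY i).pow_const 2]
  congr 1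
  ext ω
  simp

theorem integrable_exp_mul_sum_sq (hv : v ≠ 0) (hY : ∀ i, HasLaw (Y i) (gaussianReal 0 v) μ)
    (hind : iIndepFun Y μ) {t : ℝ} (ht : 2 * v * t < 1) :
    Integrable (fun ω => Real.exp (t * ∑ i, Y i ω ^ 2)) μ := by
  have := hind.isProbabilityMeasure
  refine .of_integral_ne_zero ?_
  rw [← mgf, mgf_sum_sq_eq_prod (fun i => (hY i).aemeasurable) hind]
  exact (Finset.prod_pos fun i _ =>
    mgf_pos (integrable_exp_mul_sq_of_hasLaw hv (hY i) ht)).ne'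

theorem mgf_sum_sq_le (hv : v ≠ 0) (hY : ∀ i, HasLaw (Y i) (gaussianReal 0 v) μ)
    (hind : iIndepFun Y μ) {t : ℝ} (ht : 2 * v * t ≤ 1 / 2) :
    mgf (fun ω => ∑ i, Y i ω ^ 2) μ t ≤
      Real.exp ((2 * v * t + 2 * (2 * v * t) ^ 2) / 2 * Fintype.card κ) := by
  rw [mgf_sum_sq_eq_prod (fun i => (hY i).aemeasurable) hind]
  calc ∏ i, mgf (fun ω => Y i ω ^ 2) μ t
      ≤ ∏ _i : κ, Real.exp ((2 * v * t + 2 * (2 * v * t) ^ 2) / 2) :=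
        Finset.prod_le_prod (fun _ _ => mgf_nonneg) (fun i _ => mgf_sq_le hv (hY i) ht)
    _ = _ := by rw [Finset.prod_const, ← Real.exp_nat_mul, Finset.card_univ, mul_comm]

theorem measureReal_le_sum_sq_le (hv : v ≠ 0) (hY : ∀ i, HasLaw (Y i) (gaussianReal 0 v) μ)
    (hind : iIndepFun Y μ) {δ : ℝ} (hδ : 0 ≤ δ) (hδ1 : δ ≤ 1) :
    μ.real {ω | (1 + δ) * (Fintype.card κ * v) ≤ ∑ i, Y i ω ^ 2} ≤
      Real.exp (-(δ ^ 2 / 16) * Fintype.card κ) := by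
  have := hind.isProbabilityMeasure
  have hparam : 2 * v * (δ / (8 * v)) = δ / 4 := by field_simp; ring
  refine (measure_ge_le_exp_mul_mgf _ (by positivity : 0 ≤ δ / (8 * v))
    (integrable_exp_mul_sum_sq hv hY hind (by linarith))).trans ?_
  refine (mul_le_mul_of_nonneg_left (mgf_sum_sq_le hv hY hind (by linarith))
    (Real.exp_pos _).le).trans_eq ?_
  rw [hparam, ← Real.exp_add]
  congr 1
  field_simp
  ring

theorem measureReal_sum_sq_le_le (hv : v ≠ 0) (hY : ∀ i, HasLaw (Y i) (gaussianReal 0 v) μ)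
    (hind : iIndepFun Y μ) {δ : ℝ} (hδ : 0 ≤ δ) :
    μ.real {ω | ∑ i, Y i ω ^ 2 ≤ (1 - δ) * (Fintype.card κ * v)} ≤
      Real.exp (-(δ ^ 2 / 16) * Fintype.card κ) := by
  have := hind.isProbabilityMeasure
  have hparam : 2 * v * -(δ / (8 * v)) = -(δ / 4) := by field_simp; ring
  refine (measure_le_le_exp_mul_mgf _ (neg_nonpos.2 (by positivity) : -(δ / (8 * v)) ≤ 0)
    (integrable_exp_mul_sum_sq hv hY hind (by linarith))).trans ?_
  refine (mul_le_mul_of_nonneg_left (mgf_sum_sq_le hv hY hind (by linarith))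
    (Real.exp_pos _).le).trans_eq ?_
  rw [hparam, ← Real.exp_add]
  congr 1
  field_simp
  ring

theorem measureReal_le_abs_sum_sq_sub_le (hv : v ≠ 0)
    (hY : ∀ i, HasLaw (Y i) (gaussianReal 0 v) μ) (hind : iIndepFun Y μ) {δ : ℝ}
    (hδ : 0 ≤ δ) (hδ1 : δ ≤ 1) :
    μ.real {ω | δ * (Fintype.card κ * v) ≤ |∑ i, Y i ω ^ 2 - Fintype.card κ * v|} ≤
      2 * Real.exp (-(δ ^ 2 / 16) * Fintype.card κ) := by
  have := hind.isProbabilityMeasure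
  set m : ℝ := Fintype.card κ * v
  calc μ.real {ω | δ * m ≤ |∑ i, Y i ω ^ 2 - m|}
      ≤ μ.real ({ω | (1 + δ) * m ≤ ∑ i, Y i ω ^ 2} ∪ {ω | ∑ i, Y i ω ^ 2 ≤ (1 - δ) * m}) := by
        refine measureReal_mono (fun ω hω => ?_) (measure_ne_top _ _)
        rcases le_abs.1 hω.out with h | h
        · exact .inl (by rw [Set.mem_ofPred_eq]; linarith)
        · exact .inr (by rw [Set.mem_ofPred_eq]; linarith)
    _ ≤ _ := by
        rw [two_mul]
        exact (measureReal_union_le _ _).trans (add_le_add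
          (measureReal_le_sum_sq_le hv hY hind hδ hδ1) (measureReal_sum_sq_le_le hv hY hind hδ))

end ChiSquare

section ComplexGaussian

instance isGaussian_stdComplexGaussian : IsGaussian stdComplexGaussian := by
  have hmap : stdComplexGaussian = ((gaussianReal 0 (1 / 2)).prod (gaussianReal 0 (1 / 2))).map
      (Complex.equivRealProdCLM.symm : ℝ × ℝ → ℂ) := by
    unfold stdComplexGaussian
    congr 1
    ext p
    simp [Complex.equivRealProdCLM_symm_apply]
  rw [hmap]
  infer_instance

theorem hasLaw_re_im_stdComplexGaussian : HasLaw (fun z : ℂ => (z.re, z.im))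
    ((gaussianReal 0 (1 / 2)).prod (gaussianReal 0 (1 / 2))) stdComplexGaussian where
  map_eq := by
    unfold stdComplexGaussian
    rw [Measure.map_map (by fun_prop) (by fun_prop)]
    convert Measure.map_id
    ext p <;> simp

theorem hasLaw_re_stdComplexGaussian :
    HasLaw Complex.re (gaussianReal 0 (1 / 2)) stdComplexGaussian :=
  measurePreserving_fst.comp_hasLaw hasLaw_re_im_stdComplexGaussian

theorem hasLaw_im_stdComplexGaussian :
    HasLaw Complex.im (gaussianReal 0 (1 / 2)) stdComplexGaussian :=
  measurePreserving_snd.comp_hasLaw hasLaw_re_im_stdComplexGaussian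

theorem memLp_two_re_stdComplexGaussian : MemLp Complex.re 2 stdComplexGaussian :=
  hasLaw_re_stdComplexGaussian.hasGaussianLaw.memLp_two

theorem memLp_two_im_stdComplexGaussian : MemLp Complex.im 2 stdComplexGaussian :=
  hasLaw_im_stdComplexGaussian.hasGaussianLaw.memLp_two

theorem covariance_re_im_stdComplexGaussian :
    cov[Complex.re, Complex.im; stdComplexGaussian] = 0 :=
  (hasLaw_re_im_stdComplexGaussian.covariance_fun_comp (by fun_prop) (by fun_prop)).trans
    (covariance_fst_snd_prod (X := id) (Y := id) (memLp_id_gaussianReal 2)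
      (memLp_id_gaussianReal 2))

theorem covariance_re_mul_stdComplexGaussian (a b : ℂ) :
    cov[fun z => (a * z).re, fun z => (b * z).re; stdComplexGaussian] = (a * star b).re / 2 := by
  have hre := memLp_two_re_stdComplexGaussian
  have him := memLp_two_im_stdComplexGaussian
  have hvar_re : cov[Complex.re, Complex.re; stdComplexGaussian] = 1 / 2 := by
    rw [covariance_self hre.aemeasurable, hasLaw_re_stdComplexGaussian.variance_eq]
    simp
  have hvar_im : cov[Complex.im, Complex.im; stdComplexGaussian] = 1 / 2 := by
    rw [covariance_self him.aemeasurable, hasLaw_im_stdComplexGaussian.variance_eq]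
    simp
  simp only [Complex.mul_re]
  rw [covariance_fun_sub_fun_sub (hre.const_mul _) (him.const_mul _) (hre.const_mul _)
    (him.const_mul _)]
  simp only [covariance_const_mul_left, covariance_const_mul_right, hvar_re, hvar_im,
    covariance_comm Complex.im Complex.re, covariance_re_im_stdComplexGaussian]
  simp
  ring

theorem integral_id_stdComplexGaussian : ∫ z, z ∂stdComplexGaussian = 0 := by
  have hint : Integrable (fun z : ℂ => z) stdComplexGaussian := IsGaussian.integrable_id
  apply Complex.ext
  · exact (integral_re (𝕜 := ℂ) hint).symm.trans
      (hasLaw_re_stdComplexGaussian.integral_eq.trans (by simp))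
  · exact (integral_im (𝕜 := ℂ) hint).symm.trans
      (hasLaw_im_stdComplexGaussian.integral_eq.trans (by simp))

theorem integral_norm_sq_stdComplexGaussian : ∫ z, ‖z‖ ^ 2 ∂stdComplexGaussian = 1 := by
  have hvar (f : ℂ → ℝ) (hf : HasLaw f (gaussianReal 0 (1 / 2)) stdComplexGaussian) :
      ∫ z, f z ^ 2 ∂stdComplexGaussian = 1 / 2 := by
    have hmean : ∫ z, f z ∂stdComplexGaussian = 0 := hf.integral_eq.trans (by simp)
    have hv := hf.variance_eq
    rw [variance_of_integral_eq_zero hf.aemeasurable hmean] at hv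
    simpa using hv
  simp_rw [← Complex.normSq_eq_norm_sq, Complex.normSq_apply, ← pow_two]
  rw [integral_add memLp_two_re_stdComplexGaussian.integrable_sq
    memLp_two_im_stdComplexGaussian.integrable_sq, hvar _ hasLaw_re_stdComplexGaussian,
    hvar _ hasLaw_im_stdComplexGaussian]
  norm_num

end ComplexGaussian

section Whitening

variable {Ω : Type*} [MeasurableSpace Ω] {μ : Measure Ω} {ι : Type*} {X : ι → Ω → ℂ}

theorem memLp_two_re_mul_of_hasLaw {Z : Ω → ℂ} (hZ : HasLaw Z stdComplexGaussian μ) (a : ℂ) :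
    MemLp (fun ω => (a * Z ω).re) 2 μ :=
  (hZ.hasGaussianLaw.memLp_two.const_mul a).re

theorem covariance_re_mul_of_iIndepFun [DecidableEq ι]
    (hX : ∀ s, HasLaw (X s) stdComplexGaussian μ) (hind : iIndepFun X μ) (a b : ℂ) (s t : ι) :
    cov[fun ω => (a * X s ω).re, fun ω => (b * X t ω).re; μ] =
      if s = t then (a * star b).re / 2 else 0 := by
  split_ifs with hst
  · subst hst
    exact ((hX s).covariance_fun_comp (f := fun z => (a * z).re) (g := fun z => (b * z).re)
      (by fun_prop) (by fun_prop)).trans (covariance_re_mul_stdComplexGaussian a b)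
  · have hst_indep : IndepFun (fun ω => (a * X s ω).re) (fun ω => (b * X t ω).re) μ :=
      (hind.indepFun hst).comp (φ := fun z => (a * z).re) (ψ := fun z => (b * z).re)
        (by fun_prop) (by fun_prop)
    exact hst_indep.covariance_eq_zero (memLp_two_re_mul_of_hasLaw (hX s) a)
      (memLp_two_re_mul_of_hasLaw (hX t) b)

variable [Fintype ι]

theorem integral_re_sum_mul (hX : ∀ s, HasLaw (X s) stdComplexGaussian μ) (a : ι → ℂ) :
    ∫ ω, (∑ s, a s * X s ω).re ∂μ = 0 := by
  have hint (s : ι) : Integrable (fun ω => a s * X s ω) μ :=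
    (hX s).hasGaussianLaw.integrable.const_mul (a s)
  refine (integral_re (𝕜 := ℂ) (integrable_finsetSum _ fun s _ => hint s)).trans ?_
  rw [integral_finsetSum _ fun s _ => hint s]
  simp [integral_const_mul, fun s => (hX s).integral_eq, integral_id_stdComplexGaussian]

theorem covariance_re_sum_mul (hX : ∀ s, HasLaw (X s) stdComplexGaussian μ)
    (hind : iIndepFun X μ) (a b : ι → ℂ) :
    cov[fun ω => (∑ s, a s * X s ω).re, fun ω => (∑ s, b s * X s ω).re; μ] =
      (∑ s, a s * star (b s)).re / 2 := by
  classical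
  have := hind.isProbabilityMeasure
  simp only [Complex.re_sum]
  rw [covariance_fun_sum_fun_sum (fun s => memLp_two_re_mul_of_hasLaw (hX s) (a s))
    fun t => memLp_two_re_mul_of_hasLaw (hX t) (b t)]
  simp only [covariance_re_mul_of_iIndepFun hX hind, Finset.sum_ite_eq, Finset.mem_univ, if_true,
    Finset.sum_div]

variable {β : Type*}

theorem hasGaussianLaw_re_sum_mul [Finite β] (hX : ∀ s, HasLaw (X s) stdComplexGaussian μ)
    (hind : iIndepFun X μ) (a : β → ι → ℂ) :
    HasGaussianLaw (fun ω p => (∑ s, a p s * X s ω).re) μ := by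
  have := Fintype.ofFinite β
  let L : (ι → ℂ) →L[ℝ] (β → ℝ) := ContinuousLinearMap.pi fun p =>
    Complex.reCLM.comp (∑ s, (ContinuousLinearMap.mul ℝ ℂ (a p s)).comp
      (ContinuousLinearMap.proj s))
  have hL : (fun ω p => (∑ s, a p s * X s ω).re) = fun ω => L fun s => X s ω := by
    ext ω p
    simp [L]
  rw [hL]
  exact (iIndepFun.hasGaussianLaw (fun s => (hX s).hasGaussianLaw) hind).map_fun L

theorem hasLaw_re_sum_mul (hX : ∀ s, HasLaw (X s) stdComplexGaussian μ) (hind : iIndepFun X μ)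
    {a : ι → ℂ} (ha : ∑ s, a s * star (a s) = 1) :
    HasLaw (fun ω => (∑ s, a s * X s ω).re) (gaussianReal 0 (1 / 2)) μ where
  aemeasurable := ((hasGaussianLaw_re_sum_mul hX hind fun _ : Unit => a).eval ()).aemeasurable
  map_eq := by
    have hG := (hasGaussianLaw_re_sum_mul hX hind fun _ : Unit => a).eval ()
    rw [hG.map_eq_gaussianReal, integral_re_sum_mul hX, ← covariance_self hG.aemeasurable,
      covariance_re_sum_mul hX hind, ha]
    congr 1
    ext
    norm_num

theorem iIndepFun_re_sum_mul [Finite β] (hX : ∀ s, HasLaw (X s) stdComplexGaussian μ)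
    (hind : iIndepFun X μ) {a : β → ι → ℂ}
    (ha : Pairwise fun p q => (∑ s, a p s * star (a q s)).re = 0) :
    iIndepFun (fun p ω => (∑ s, a p s * X s ω).re) μ :=
  have := hind.isProbabilityMeasure
  (hasGaussianLaw_re_sum_mul hX hind a).iIndepFun_of_covariance_eq_zero fun p q hpq => by
    rw [covariance_re_sum_mul hX hind, ha hpq, zero_div]

/-- The coefficients of the real combinations giving the real part (`p.2 = true`) and the imaginary
part (`p.2 = false`, as `Im z = Re (-i z)`) of `∑ s, A p.1 s * X s`. -/
def realCoordinates (A : β → ι → ℂ) (p : β × Bool) (s : ι) : ℂ :=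
  (if p.2 then 1 else -Complex.I) * A p.1 s

theorem sum_realCoordinates_mul_star (A : β → ι → ℂ) (p q : β × Bool) :
    ∑ s, realCoordinates A p s * star (realCoordinates A q s) =
      (if p.2 then 1 else -Complex.I) * star (if q.2 then 1 else -Complex.I) *
        ∑ s, A p.1 s * star (A q.1 s) := by
  rw [Finset.mul_sum]
  refine Finset.sum_congr rfl fun s _ => ?_
  rw [realCoordinates, realCoordinates, star_mul']
  ring

theorem sum_sq_re_sum_realCoordinates_mul [Fintype β] (A : β → ι → ℂ) (x : ι → ℂ) :
    ∑ p, (∑ s, realCoordinates A p s * x s).re ^ 2 = ∑ b, ‖∑ s, A b s * x s‖ ^ 2 := by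
  simp_rw [Fintype.sum_prod_type, Fintype.sum_bool, ← Complex.normSq_eq_norm_sq,
    Complex.normSq_apply, realCoordinates, mul_assoc, ← Finset.mul_sum]
  simp [pow_two]

theorem measureReal_le_abs_sum_norm_sq_sub_le [Fintype β] [DecidableEq β]
    (hX : ∀ s, HasLaw (X s) stdComplexGaussian μ) (hind : iIndepFun X μ) {A : β → ι → ℂ}
    (hA : ∀ b b', ∑ s, A b s * star (A b' s) = if b = b' then 1 else 0)
    {δ : ℝ} (hδ : 0 ≤ δ) (hδ1 : δ ≤ 1) :
    μ.real {ω | δ * Fintype.card β ≤ |∑ b, ‖∑ s, A b s * X s ω‖ ^ 2 - Fintype.card β|} ≤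
      2 * Real.exp (-(δ ^ 2 / 8) * Fintype.card β) := by
  have hlaw (p : β × Bool) := hasLaw_re_sum_mul hX hind (a := realCoordinates A p) <| by
    rw [sum_realCoordinates_mul_star, hA, if_pos rfl]
    split_ifs <;> simp
  have hindep := iIndepFun_re_sum_mul hX hind (a := realCoordinates A) <| by
    rintro ⟨b, r⟩ ⟨b', r'⟩ hne
    simp only [sum_realCoordinates_mul_star, hA]
    by_cases hb : b = b' <;> cases r <;> cases r' <;> simp_all
  have hdev := measureReal_le_abs_sum_sq_sub_le (by norm_num) hlaw hindep hδ hδ1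
  have hcard : (Fintype.card (β × Bool) : ℝ) = 2 * Fintype.card β := by
    simp [mul_comm]
  have hhalf : 2 * (Fintype.card β : ℝ) * (1 / 2 : NNReal) = Fintype.card β := by
    push_cast
    ring
  simp_rw [sum_sq_re_sum_realCoordinates_mul, hcard, hhalf] at hdev
  refine hdev.trans_eq ?_
  ring_nf

end Whitening

section SeriesOfIntegrable

variable {Ω : Type*} [MeasurableSpace Ω] {μ : Measure Ω} {E : Type*} [NormedAddCommGroup E]
  {ι : Type*} [Countable ι] {F : ι → Ω → E}

theorem lintegral_tsum_enorm_ne_top (hF : ∀ i, Integrable (F i) μ)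
    (hs : Summable fun i => ∫ ω, ‖F i ω‖ ∂μ) : ∫⁻ ω, ∑' i, ‖F i ω‖ₑ ∂μ ≠ ⊤ := by
  rw [lintegral_tsum fun i => (hF i).1.enorm]
  simp_rw [fun i => (ofReal_integral_norm_eq_lintegral_enorm (hF i)).symm]
  rw [← ENNReal.ofReal_tsum_of_nonneg (fun i => integral_nonneg fun _ => norm_nonneg _) hs]
  exact ENNReal.ofReal_ne_top

theorem ae_summable_norm_of_summable_integral (hF : ∀ i, Integrable (F i) μ)
    (hs : Summable fun i => ∫ ω, ‖F i ω‖ ∂μ) : ∀ᵐ ω ∂μ, Summable fun i => ‖F i ω‖ := by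
  filter_upwards [ae_lt_top' (AEMeasurable.tsum fun i => (hF i).1.enorm)
    (lintegral_tsum_enorm_ne_top hF hs)] with ω hω
  simpa using ENNReal.summable_toReal hω.ne

theorem integrable_of_ae_hasSum (hF : ∀ i, Integrable (F i) μ)
    (hs : Summable fun i => ∫ ω, ‖F i ω‖ ∂μ) {U : Ω → E}
    (hU : ∀ᵐ ω ∂μ, HasSum (fun i => F i ω) (U ω)) : Integrable U μ := by
  refine ⟨aestronglyMeasurable_of_tendsto_ae _ (fun s => ?_) hU, ?_⟩
  · exact Finset.aestronglyMeasurable_fun_sum s fun i _ => (hF i).1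
  · refine (lintegral_mono_ae ?_).trans_lt (lintegral_tsum_enorm_ne_top hF hs).lt_top
    filter_upwards [hU] with ω hω
    rw [← hω.tsum_eq]
    exact enorm_tsum_le_tsum_enorm

theorem hasSum_integral_of_ae_hasSum [NormedSpace ℝ E] (hF : ∀ i, Integrable (F i) μ)
    (hs : Summable fun i => ∫ ω, ‖F i ω‖ ∂μ) {U : Ω → E}
    (hU : ∀ᵐ ω ∂μ, HasSum (fun i => F i ω) (U ω)) :
    HasSum (fun i => ∫ ω, F i ω ∂μ) (∫ ω, U ω ∂μ) := by
  rw [integral_congr_ae (hU.mono fun _ hω => hω.tsum_eq.symm)]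
  exact hasSum_integral_of_summable_integral_norm hF hs

end SeriesOfIntegrable

theorem hasSum_mul_star {α β : Type*} {f : α → ℂ} {g : β → ℂ} {s t : ℂ} (hf : HasSum f s)
    (hg : HasSum g t) : HasSum (fun p : α × β => f p.1 * star (g p.2)) (s * star t) :=
  hf.mul (g := fun b => star (g b)) hg.star
    (summable_mul_of_summable_norm (f := f) (g := fun b => star (g b)) hf.summable.norm
      hg.star.summable.norm)

section WhiteFamily

/-- A second-order white noise: centred complex random variables that are orthonormal in
`L²(μ)`. This is all that the spectral density of a filtered noise depends on. -/
structure IsWhiteFamily {Ω ι : Type*} [MeasurableSpace Ω] (Z : ι → Ω → ℂ) (μ : Measure Ω) :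
    Prop where
  memLp_two : ∀ s, MemLp (Z s) 2 μ
  integral_eq_zero : ∀ s, ∫ ω, Z s ω ∂μ = 0
  integral_norm_sq : ∀ s, ∫ ω, ‖Z s ω‖ ^ 2 ∂μ = 1
  integral_mul_star_eq_zero : Pairwise fun s t => ∫ ω, Z s ω * star (Z t ω) ∂μ = 0

variable {Ω : Type*} [MeasurableSpace Ω] {μ : Measure Ω} {ι : Type*}

theorem isWhiteFamily_of_iIndepFun {Z : ι → Ω → ℂ} (hZ : ∀ s, HasLaw (Z s) stdComplexGaussian μ)
    (hind : iIndepFun Z μ) : IsWhiteFamily Z μ where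
  memLp_two s := (hZ s).hasGaussianLaw.memLp_two
  integral_eq_zero s := (hZ s).integral_eq.trans integral_id_stdComplexGaussian
  integral_norm_sq s := ((hZ s).integral_comp (f := fun z => ‖z‖ ^ 2) (by fun_prop)).trans
    integral_norm_sq_stdComplexGaussian
  integral_mul_star_eq_zero s t hst := by
    have hindep := (hind.indepFun hst).comp (φ := id) (ψ := star) measurable_id
      continuous_star.measurable
    have hmul := hindep.integral_fun_mul_eq_mul_integral
      (hZ s).aemeasurable.aestronglyMeasurable
      (continuous_star.measurable.comp_aemeasurable (hZ t).aemeasurable).aestronglyMeasurable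
    refine hmul.trans ?_
    simp only [Function.comp_apply, id, (hZ s).integral_eq, integral_id_stdComplexGaussian,
      zero_mul]

namespace IsWhiteFamily

variable {Z : ι → Ω → ℂ}

theorem integrable_mul_star (hZ : IsWhiteFamily Z μ) (s t : ι) :
    Integrable (fun ω => Z s ω * star (Z t ω)) μ :=
  (hZ.memLp_two s).integrable_mul (hZ.memLp_two t).star

theorem integral_mul_star [DecidableEq ι] (hZ : IsWhiteFamily Z μ) (s t : ι) :
    ∫ ω, Z s ω * star (Z t ω) ∂μ = if s = t then 1 else 0 := by
  split_ifs with hst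
  · subst hst
    have hnorm (ω : Ω) : Z s ω * star (Z s ω) = ((‖Z s ω‖ ^ 2 : ℝ) : ℂ) := by
      rw [Complex.star_def, Complex.mul_conj, Complex.normSq_eq_norm_sq]
    simp_rw [hnorm]
    rw [integral_complex_ofReal, hZ.integral_norm_sq, Complex.ofReal_one]
  · exact hZ.integral_mul_star_eq_zero hst

theorem integrable_norm_sq (hZ : IsWhiteFamily Z μ) (s : ι) :
    Integrable (fun ω => ‖Z s ω‖ ^ 2) μ :=
  (hZ.memLp_two s).integrable_norm_pow two_ne_zero

theorem integrable_norm_mul_norm (hZ : IsWhiteFamily Z μ) (s t : ι) :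
    Integrable (fun ω => ‖Z s ω‖ * ‖Z t ω‖) μ :=
  (hZ.memLp_two s).norm.integrable_mul (hZ.memLp_two t).norm

theorem integral_norm_mul_norm_le_one (hZ : IsWhiteFamily Z μ) (s t : ι) :
    ∫ ω, ‖Z s ω‖ * ‖Z t ω‖ ∂μ ≤ 1 := by
  calc ∫ ω, ‖Z s ω‖ * ‖Z t ω‖ ∂μ
      ≤ ∫ ω, (‖Z s ω‖ ^ 2 / 2 + ‖Z t ω‖ ^ 2 / 2) ∂μ :=
        integral_mono (hZ.integrable_norm_mul_norm s t)
          (((hZ.integrable_norm_sq s).div_const 2).add ((hZ.integrable_norm_sq t).div_const 2))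
          fun ω => by nlinarith [sq_nonneg (‖Z s ω‖ - ‖Z t ω‖)]
    _ = 1 := by
        rw [integral_add ((hZ.integrable_norm_sq s).div_const 2)
          ((hZ.integrable_norm_sq t).div_const 2), integral_div, integral_div,
          hZ.integral_norm_sq, hZ.integral_norm_sq]
        norm_num

theorem integrable [IsFiniteMeasure μ] (hZ : IsWhiteFamily Z μ) (s : ι) : Integrable (Z s) μ :=
  (hZ.memLp_two s).integrable one_le_two

theorem integral_norm_le_one [IsProbabilityMeasure μ] (hZ : IsWhiteFamily Z μ) (s : ι) :
    ∫ ω, ‖Z s ω‖ ∂μ ≤ 1 := by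
  calc ∫ ω, ‖Z s ω‖ ∂μ ≤ ∫ ω, (‖Z s ω‖ ^ 2 / 2 + 1 / 2) ∂μ :=
        integral_mono (hZ.integrable s).norm
          (((hZ.integrable_norm_sq s).div_const 2).add (integrable_const _))
          fun ω => by nlinarith [sq_nonneg (‖Z s ω‖ - 1)]
    _ = 1 := by
        rw [integral_add ((hZ.integrable_norm_sq s).div_const 2) (integrable_const _),
          integral_div, hZ.integral_norm_sq]
        norm_num

section Series

variable {a b : ι → ℂ} {U V : Ω → ℂ}

theorem summable_integral_norm_mul [IsProbabilityMeasure μ] (hZ : IsWhiteFamily Z μ)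
    (ha : Summable fun s => ‖a s‖) : Summable fun s => ∫ ω, ‖a s * Z s ω‖ ∂μ := by
  refine ha.of_nonneg_of_le (fun s => integral_nonneg fun _ => norm_nonneg _) fun s => ?_
  simp_rw [norm_mul, integral_const_mul]
  exact mul_le_of_le_one_right (norm_nonneg _) (hZ.integral_norm_le_one s)

theorem integrable_mul_star_mul (hZ : IsWhiteFamily Z μ) (p : ι × ι) :
    Integrable (fun ω => a p.1 * Z p.1 ω * star (b p.2 * Z p.2 ω)) μ := by
  simp_rw [star_mul', fun ω => mul_mul_mul_comm (a p.1) (Z p.1 ω) (star (b p.2)) (star (Z p.2 ω))]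
  exact (hZ.integrable_mul_star _ _).const_mul _

theorem summable_integral_norm_mul_star (hZ : IsWhiteFamily Z μ)
    (ha : Summable fun s => ‖a s‖) (hb : Summable fun s => ‖b s‖) :
    Summable fun p : ι × ι => ∫ ω, ‖a p.1 * Z p.1 ω * star (b p.2 * Z p.2 ω)‖ ∂μ := by
  refine (ha.mul_of_nonneg hb (fun _ => norm_nonneg _) fun _ => norm_nonneg _).of_nonneg_of_le
    (fun p => integral_nonneg fun _ => norm_nonneg _) fun p => ?_
  have hnorm (ω : Ω) : ‖a p.1 * Z p.1 ω * star (b p.2 * Z p.2 ω)‖ =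
      ‖a p.1‖ * ‖b p.2‖ * (‖Z p.1 ω‖ * ‖Z p.2 ω‖) := by
    rw [norm_mul, norm_star, norm_mul, norm_mul, mul_mul_mul_comm]
  simp_rw [hnorm, integral_const_mul]
  exact mul_le_of_le_one_right (by positivity) (hZ.integral_norm_mul_norm_le_one _ _)

theorem ae_hasSum_mul_star (hU : ∀ᵐ ω ∂μ, HasSum (fun s => a s * Z s ω) (U ω))
    (hV : ∀ᵐ ω ∂μ, HasSum (fun s => b s * Z s ω) (V ω)) :
    ∀ᵐ ω ∂μ, HasSum (fun p : ι × ι => a p.1 * Z p.1 ω * star (b p.2 * Z p.2 ω))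
      (U ω * star (V ω)) := by
  filter_upwards [hU, hV] with ω hUω hVω
  exact hasSum_mul_star (f := fun s => a s * Z s ω) (g := fun s => b s * Z s ω) hUω hVω

variable [Countable ι]

theorem ae_summable_norm_mul [IsProbabilityMeasure μ] (hZ : IsWhiteFamily Z μ)
    (ha : Summable fun s => ‖a s‖) : ∀ᵐ ω ∂μ, Summable fun s => ‖a s * Z s ω‖ :=
  ae_summable_norm_of_summable_integral (fun s => (hZ.integrable s).const_mul (a s))
    (hZ.summable_integral_norm_mul ha)

theorem integrable_of_ae_hasSum [IsProbabilityMeasure μ] (hZ : IsWhiteFamily Z μ)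
    (ha : Summable fun s => ‖a s‖) (hU : ∀ᵐ ω ∂μ, HasSum (fun s => a s * Z s ω) (U ω)) :
    Integrable U μ :=
  _root_.integrable_of_ae_hasSum (fun s => (hZ.integrable s).const_mul (a s))
    (hZ.summable_integral_norm_mul ha) hU

theorem integral_eq_zero_of_ae_hasSum [IsProbabilityMeasure μ] (hZ : IsWhiteFamily Z μ)
    (ha : Summable fun s => ‖a s‖) (hU : ∀ᵐ ω ∂μ, HasSum (fun s => a s * Z s ω) (U ω)) :
    ∫ ω, U ω ∂μ = 0 := by
  have hsum := hasSum_integral_of_ae_hasSum (fun s => (hZ.integrable s).const_mul (a s))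
    (hZ.summable_integral_norm_mul ha) hU
  simp_rw [integral_const_mul, hZ.integral_eq_zero, mul_zero] at hsum
  exact hsum.unique hasSum_zero

theorem integrable_mul_star_of_ae_hasSum (hZ : IsWhiteFamily Z μ)
    (ha : Summable fun s => ‖a s‖) (hb : Summable fun s => ‖b s‖)
    (hU : ∀ᵐ ω ∂μ, HasSum (fun s => a s * Z s ω) (U ω))
    (hV : ∀ᵐ ω ∂μ, HasSum (fun s => b s * Z s ω) (V ω)) :
    Integrable (fun ω => U ω * star (V ω)) μ :=
  _root_.integrable_of_ae_hasSum hZ.integrable_mul_star_mul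
    (hZ.summable_integral_norm_mul_star ha hb) (ae_hasSum_mul_star hU hV)

theorem hasSum_integral_mul_star (hZ : IsWhiteFamily Z μ)
    (ha : Summable fun s => ‖a s‖) (hb : Summable fun s => ‖b s‖)
    (hU : ∀ᵐ ω ∂μ, HasSum (fun s => a s * Z s ω) (U ω))
    (hV : ∀ᵐ ω ∂μ, HasSum (fun s => b s * Z s ω) (V ω)) :
    HasSum (fun s => a s * star (b s)) (∫ ω, U ω * star (V ω) ∂μ) := by
  classical
  have hsum := hasSum_integral_of_ae_hasSum hZ.integrable_mul_star_mul
    (hZ.summable_integral_norm_mul_star ha hb) (ae_hasSum_mul_star hU hV)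
  simp_rw [star_mul', fun (p : ι × ι) ω =>
    mul_mul_mul_comm (a p.1) (Z p.1 ω) (star (b p.2)) (star (Z p.2 ω)), integral_const_mul,
    hZ.integral_mul_star] at hsum
  have hdiag : Function.Injective fun s : ι => (s, s) := fun s t hst => (Prod.ext_iff.1 hst).1
  rw [← hdiag.hasSum_iff fun p hp => by
    rw [if_neg fun hp' => hp ⟨p.1, Prod.ext rfl hp'⟩, mul_zero]] at hsum
  simpa [Function.comp_def] using hsum

end Series

end IsWhiteFamily

theorem IsComplexGaussianWhiteNoise.isWhiteFamily {K : ℕ} {ε : ℤ → Ω → Fin K → ℂ}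
    (hε : IsComplexGaussianWhiteNoise ε μ) :
    IsWhiteFamily (fun (p : ℤ × Fin K) ω => ε p.1 ω p.2) μ :=
  isWhiteFamily_of_iIndepFun (fun p => hε.law p.1 p.2) hε.indep

end WhiteFamily

section FiniteFourier

theorem sum_exp_eq_ite_dvd {N : ℕ} (hN : N ≠ 0) (d : ℤ) :
    ∑ n : Fin N, Complex.exp (-(2 * (Real.pi : ℂ) * Complex.I * (n : ℂ) * ((d : ℂ) / N))) =
      if (N : ℤ) ∣ d then (N : ℂ) else 0 := by
  have hζ := Complex.isPrimitiveRoot_exp N hN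
  set ζ := Complex.exp (2 * (Real.pi : ℂ) * Complex.I / N) with hζ_def
  have hpow (n : Fin N) : Complex.exp (-(2 * (Real.pi : ℂ) * Complex.I * (n : ℂ) * ((d : ℂ) / N)))
      = (ζ ^ (-d)) ^ (n : ℕ) := by
    rw [hζ_def, ← Complex.exp_int_mul, ← Complex.exp_nat_mul]
    congr 1
    push_cast
    ring
  simp_rw [hpow, Fin.sum_univ_eq_sum_range fun n => (ζ ^ (-d)) ^ n]
  split_ifs with hd
  · rw [(hζ.zpow_eq_one_iff_dvd _).2 ((dvd_neg).2 hd)]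
    simp
  · have hne : ζ ^ (-d) ≠ 1 := fun h => hd ((dvd_neg).1 ((hζ.zpow_eq_one_iff_dvd _).1 h))
    rw [geom_sum_eq hne, ← zpow_natCast, ← zpow_mul, mul_comm, zpow_mul, zpow_natCast,
      hζ.pow_eq_one, one_zpow, sub_self, zero_div]

variable {K : ℕ}

/-- The coefficients of `star v ⬝ᵥ finiteFourier N x ν` as a linear form in the scalars
`x 0 i, …, x (N - 1) i`. -/
noncomputable def fourierCoefficient (N : ℕ) (v : Fin K → ℂ) (ν : ℝ) (p : Fin N × Fin K) : ℂ :=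
  1 / (Real.sqrt (N : ℝ) : ℂ) *
    Complex.exp (-(2 * (Real.pi : ℂ) * Complex.I * (p.1 : ℂ) * (ν : ℂ))) * star (v p.2)

theorem star_dotProduct_finiteFourier (N : ℕ) (x : ℤ → Fin K → ℂ) (v : Fin K → ℂ) (ν : ℝ) :
    star v ⬝ᵥ finiteFourier N x ν = ∑ p, fourierCoefficient N v ν p * x (p.1 : ℕ) p.2 := by
  simp only [Fintype.sum_prod_type, fourierCoefficient]
  rw [Fin.sum_univ_eq_sum_range (fun n : ℕ => ∑ i,
    1 / (Real.sqrt (N : ℝ) : ℂ) * Complex.exp (-(2 * (Real.pi : ℂ) * Complex.I * (n : ℂ) *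
      (ν : ℂ))) * star (v i) * x n i) N, Finset.sum_comm]
  simp only [dotProduct, finiteFourier, Pi.smul_apply, Finset.sum_apply, smul_eq_mul,
    Pi.star_apply, Finset.mul_sum]
  refine Finset.sum_congr rfl fun i _ => Finset.sum_congr rfl fun n _ => ?_
  ring

theorem fourierCoefficient_mul_star {N : ℕ} (v : Fin K → ℂ) (ν ν' : ℝ) (p : Fin N × Fin K) :
    fourierCoefficient N v ν p * star (fourierCoefficient N v ν' p) =
      (N : ℂ)⁻¹ * Complex.exp (-(2 * (Real.pi : ℂ) * Complex.I * (p.1 : ℂ) *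
        ((ν - ν' : ℝ) : ℂ))) * (star (v p.2) * v p.2) := by
  have hexp : Complex.exp (-(2 * (Real.pi : ℂ) * Complex.I * (p.1 : ℂ) * ((ν - ν' : ℝ) : ℂ))) =
      Complex.exp (-(2 * (Real.pi : ℂ) * Complex.I * (p.1 : ℂ) * (ν : ℂ))) *
        star (Complex.exp (-(2 * (Real.pi : ℂ) * Complex.I * (p.1 : ℂ) * (ν' : ℂ)))) := by
    rw [Complex.star_def, ← Complex.exp_conj, ← Complex.exp_add]
    congr 1
    simp only [map_neg, map_mul, Complex.conj_I, Complex.conj_ofReal, map_ofNat, map_natCast]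
    push_cast
    ring
  have hsqrt : (N : ℂ)⁻¹ =
      1 / (Real.sqrt (N : ℝ) : ℂ) * star (1 / (Real.sqrt (N : ℝ) : ℂ)) := by
    rw [Complex.star_def, map_div₀, map_one, Complex.conj_ofReal, div_mul_div_comm,
      ← Complex.ofReal_mul, Real.mul_self_sqrt (Nat.cast_nonneg N)]
    simp
  rw [hexp, hsqrt, fourierCoefficient, fourierCoefficient, star_mul', star_mul', star_star]
  ring

theorem sum_fourierCoefficient_mul_star {N : ℕ} (hN : N ≠ 0) (v : Fin K → ℂ) (ν : ℝ) (b b' : ℤ) :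
    ∑ p, fourierCoefficient N v (ν + (b : ℝ) / N) p *
      star (fourierCoefficient N v (ν + (b' : ℝ) / N) p) =
        if (N : ℤ) ∣ b - b' then star v ⬝ᵥ v else 0 := by
  have hfreq : ((ν + (b : ℝ) / N - (ν + (b' : ℝ) / N) : ℝ) : ℂ) = ((b - b' : ℤ) : ℂ) / N := by
    push_cast
    ring
  have hN' : (N : ℂ) ≠ 0 := Nat.cast_ne_zero.2 hN
  simp_rw [fourierCoefficient_mul_star, hfreq, Fintype.sum_prod_type, ← Finset.mul_sum,
    ← Finset.sum_mul, ← Finset.mul_sum]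
  rw [sum_exp_eq_ite_dvd hN]
  split_ifs
  · rw [inv_mul_cancel₀ hN', one_mul]
    rfl
  · simp

end FiniteFourier

section Periodogram

theorem star_dotProduct_smoothedPeriodogram_mulVec {K : ℕ} (N B : ℕ) (x : ℤ → Fin K → ℂ)
    (v : Fin K → ℂ) (ν : ℝ) :
    star v ⬝ᵥ smoothedPeriodogram N B x ν *ᵥ v =
      ((((B : ℝ) + 1)⁻¹ * ∑ b ∈ Finset.Icc (-((B : ℤ) / 2)) ((B : ℤ) / 2),
        ‖star v ⬝ᵥ finiteFourier N x (ν + (b : ℝ) / N)‖ ^ 2 : ℝ) : ℂ) := by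
  have hrank_one (z : Fin K → ℂ) :
      star v ⬝ᵥ Matrix.vecMulVec z (star z) *ᵥ v = ((‖star v ⬝ᵥ z‖ ^ 2 : ℝ) : ℂ) := by
    rw [Matrix.vecMulVec_mulVec, ← Complex.normSq_eq_norm_sq, ← Complex.mul_conj,
      ← Complex.star_def, ← Matrix.star_dotProduct]
    simp [mul_comm]
  simp only [smoothedPeriodogram, Matrix.smul_mulVec, Matrix.sum_mulVec, dotProduct_smul,
    dotProduct_sum, hrank_one]
  push_cast
  simp

theorem card_Icc_neg_half_half {B : ℕ} (hB : Even B) :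
    (Finset.Icc (-((B : ℤ) / 2)) ((B : ℤ) / 2)).card = B + 1 := by
  obtain ⟨m, rfl⟩ := hB
  rw [Int.card_Icc]
  omega

theorem natCast_dvd_sub_iff_of_mem_Icc {N B : ℕ} (hBN : B < N) {b b' : ℤ}
    (hb : b ∈ Finset.Icc (-((B : ℤ) / 2)) ((B : ℤ) / 2))
    (hb' : b' ∈ Finset.Icc (-((B : ℤ) / 2)) ((B : ℤ) / 2)) : (N : ℤ) ∣ b - b' ↔ b = b' := by
  rw [Finset.mem_Icc] at hb hb'
  refine ⟨fun h => ?_, fun h => by simp [h]⟩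
  exact sub_eq_zero.1 (Int.eq_zero_of_abs_lt_dvd h (abs_lt.2 ⟨by omega, by omega⟩))

variable {K : ℕ}

theorem norm_star_dotProduct_smoothedPeriodogram_sub_one_mulVec {N B : ℕ} (hB : Even B)
    (x : ℤ → Fin K → ℂ) {v : Fin K → ℂ} (hv : star v ⬝ᵥ v = 1) (ν : ℝ) :
    ‖star v ⬝ᵥ (smoothedPeriodogram N B x ν - 1) *ᵥ v‖ =
      |∑ b : Finset.Icc (-((B : ℤ) / 2)) ((B : ℤ) / 2),
        ‖∑ p, fourierCoefficient N v (ν + ((b : ℤ) : ℝ) / N) p * x (p.1 : ℕ) p.2‖ ^ 2 -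
          Fintype.card (Finset.Icc (-((B : ℤ) / 2)) ((B : ℤ) / 2))| /
            Fintype.card (Finset.Icc (-((B : ℤ) / 2)) ((B : ℤ) / 2)) := by
  have hcard : (0 : ℝ) < (B : ℝ) + 1 := by positivity
  rw [Matrix.sub_mulVec, Matrix.one_mulVec, dotProduct_sub, hv,
    star_dotProduct_smoothedPeriodogram_mulVec, ← Complex.ofReal_one, ← Complex.ofReal_sub,
    Complex.norm_real, Real.norm_eq_abs, Fintype.card_coe, card_Icc_neg_half_half hB,
    Finset.sum_coe_sort _ fun b : ℤ =>
      ‖∑ p, fourierCoefficient N v (ν + (b : ℝ) / N) p * x (p.1 : ℕ) p.2‖ ^ 2]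
  simp_rw [← star_dotProduct_finiteFourier]
  push_cast
  rw [← abs_of_pos hcard, ← abs_div, abs_of_pos hcard, sub_div, div_self hcard.ne',
    div_eq_inv_mul]

variable {Ω : Type*} [MeasurableSpace Ω] {μ : Measure Ω} {ε : ℤ → Ω → Fin K → ℂ}

theorem IsComplexGaussianWhiteNoise.measureReal_le_norm_star_dotProduct_le
    (hε : IsComplexGaussianWhiteNoise ε μ) {N B : ℕ} (hB : Even B) (hBN : B < N)
    {v : Fin K → ℂ} (hv : star v ⬝ᵥ v = 1) (ν : ℝ) {δ : ℝ} (hδ : 0 ≤ δ) (hδ1 : δ ≤ 1) :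
    μ.real {ω | δ ≤
      ‖star v ⬝ᵥ (smoothedPeriodogram N B (fun n => ε n ω) ν - 1) *ᵥ v‖} ≤
        2 * Real.exp (-(δ ^ 2 / 8) * (B + 1)) := by
  have hinj : Function.Injective fun p : Fin N × Fin K => (((p.1 : ℕ) : ℤ), p.2) :=
    (Nat.cast_injective.comp Fin.val_injective).prodMap Function.injective_id
  have hcard : (Fintype.card (Finset.Icc (-((B : ℤ) / 2)) ((B : ℤ) / 2)) : ℝ) = B + 1 := by
    rw [Fintype.card_coe, card_Icc_neg_half_half hB]
    push_cast
    rfl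
  have hdev := measureReal_le_abs_sum_norm_sq_sub_le
    (X := fun (p : Fin N × Fin K) ω => ε (p.1 : ℕ) ω p.2) (fun p => hε.law _ _)
    (hε.indep.precomp hinj)
    (A := fun b : Finset.Icc (-((B : ℤ) / 2)) ((B : ℤ) / 2) =>
      fourierCoefficient N v (ν + ((b : ℤ) : ℝ) / N))
    (fun b b' => by
      rw [sum_fourierCoefficient_mul_star (by omega), hv]
      simp only [natCast_dvd_sub_iff_of_mem_Icc hBN b.2 b'.2, Subtype.coe_inj]) hδ hδ1
  simp_rw [norm_star_dotProduct_smoothedPeriodogram_sub_one_mulVec hB _ hv]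
  rw [hcard] at hdev ⊢
  simpa only [le_div_iff₀ (show (0 : ℝ) < B + 1 by positivity)] using hdev

end Periodogram

section UniformAtTop

/-- Convergence along this filter is convergence as `M → ∞`, uniformly over `ι M`. With
`ι M = Fin (N M)` it expresses the limit `M → ∞` uniformly over the Fourier frequencies
`k / N M`. -/
def uniformAtTop (ι : ℕ → Type*) : Filter (Σ M, ι M) :=
  comap Sigma.fst atTop

variable {ι : ℕ → Type*}

theorem eventually_uniformAtTop {P : (Σ M, ι M) → Prop} :
    (∀ᶠ p in uniformAtTop ι, P p) ↔ ∀ᶠ M in atTop, ∀ k, P ⟨M, k⟩ := by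
  refine eventually_comap.trans (eventually_congr (.of_forall fun M => ⟨?_, ?_⟩))
  · exact fun h k => h _ rfl
  · rintro h ⟨_, k⟩ rfl
    exact h k

theorem tendsto_comp_fst_uniformAtTop {α : Type*} {l : Filter α} {f : ℕ → α}
    (hf : Tendsto f atTop l) : Tendsto (fun p : Σ M, ι M => f p.1) (uniformAtTop ι) l :=
  hf.comp tendsto_comap

theorem tendsto_iSup_of_tendsto_uniformAtTop {f : (Σ M, ι M) → ℝ} (hf0 : ∀ p, 0 ≤ f p)
    (hf : Tendsto f (uniformAtTop ι) (𝓝 0)) :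
    Tendsto (fun M => ⨆ k, f ⟨M, k⟩) atTop (𝓝 0) := by
  rw [Metric.tendsto_nhds] at hf ⊢
  intro δ hδ
  filter_upwards [eventually_uniformAtTop.1 (hf (δ / 2) (half_pos hδ))] with M hM
  rw [dist_zero_right, Real.norm_of_nonneg (Real.iSup_nonneg fun k => hf0 _)]
  refine (Real.iSup_le (fun k => ?_) (half_pos hδ).le).trans_lt (half_lt_self hδ)
  simpa only [dist_zero_right, Real.norm_of_nonneg (hf0 _)] using (hM k).le

variable {Ω : Type*} [MeasurableSpace Ω] {μ : Measure Ω} [IsFiniteMeasure μ]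

theorem ae_eventually_notMem_of_eventually_le_of_summable {s : ℕ → Set Ω} {g : ℕ → ℝ}
    (hg : Summable g) (hs : ∀ᶠ M in atTop, μ.real (s M) ≤ g M) :
    ∀ᵐ ω ∂μ, ∀ᶠ M in atTop, ω ∉ s M := by
  obtain ⟨M₀, hM₀⟩ := eventually_atTop.1 hs
  have hsum : Summable fun M => μ.real (s (M + M₀)) :=
    .of_nonneg_of_le (fun _ => measureReal_nonneg) (fun M => hM₀ _ (Nat.le_add_left _ _))
      ((summable_nat_add_iff M₀).2 hg)
  have htsum : ∑' M, μ (s (M + M₀)) ≠ ⊤ := by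
    simpa only [ofReal_measureReal (measure_ne_top μ _)] using hsum.tsum_ofReal_ne_top
  filter_upwards [ae_eventually_notMem htsum] with ω hω
  obtain ⟨M₁, hM₁⟩ := eventually_atTop.1 hω
  refine eventually_atTop.2 ⟨M₁ + M₀, fun M hM => ?_⟩
  simpa only [Nat.sub_add_cancel (show M₀ ≤ M by omega)] using hM₁ (M - M₀) (by omega)

theorem ae_tendsto_uniformAtTop [∀ M, Fintype (ι M)] {E : Type*} [SeminormedAddCommGroup E]
    {Y : (Σ M, ι M) → Ω → E} {g : ℕ → ℝ} (hg : Summable g)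
    (hY : ∀ δ : ℝ, 0 < δ → δ ≤ 1 →
      ∀ᶠ M in atTop, ∑ k, μ.real {ω | δ ≤ ‖Y ⟨M, k⟩ ω‖} ≤ g M) :
    ∀ᵐ ω ∂μ, Tendsto (fun p => Y p ω) (uniformAtTop ι) (𝓝 0) := by
  have hae (n : ℕ) : ∀ᵐ ω ∂μ, ∀ᶠ M in atTop,
      ω ∉ ⋃ k, {ω | 1 / ((n : ℝ) + 1) ≤ ‖Y ⟨M, k⟩ ω‖} := by
    refine ae_eventually_notMem_of_eventually_le_of_summable hg ?_
    filter_upwards [hY (1 / ((n : ℝ) + 1)) (by positivity)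
      (div_le_one_of_le₀ (by simp) (by positivity))] with M hM
    exact (measureReal_iUnion_fintype_le _).trans hM
  filter_upwards [ae_all_iff.2 hae] with ω hω
  rw [tendsto_zero_iff_norm_tendsto_zero, Metric.tendsto_nhds]
  intro δ hδ
  obtain ⟨n, hn⟩ := exists_nat_one_div_lt hδ
  refine eventually_uniformAtTop.2 ((hω n).mono fun M hM k => ?_)
  simp only [Set.mem_iUnion, Set.mem_ofPred_eq, not_exists, not_le] at hM
  simpa using (hM k).trans hn

end UniformAtTop

section Polarization

variable {n : Type*} [Fintype n]

theorem four_mul_star_dotProduct_mulVec (A : Matrix n n ℂ) (x y : n → ℂ) :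
    4 * (star x ⬝ᵥ A *ᵥ y) =
      star (x + y) ⬝ᵥ A *ᵥ (x + y) - star (x - y) ⬝ᵥ A *ᵥ (x - y) -
        Complex.I * (star (x + Complex.I • y) ⬝ᵥ A *ᵥ (x + Complex.I • y)) +
          Complex.I * (star (x - Complex.I • y) ⬝ᵥ A *ᵥ (x - Complex.I • y)) := by
  simp only [star_add, star_sub, star_smul, Complex.star_def, Complex.conj_I, Matrix.mulVec_add,
    Matrix.mulVec_sub, Matrix.mulVec_smul, add_dotProduct, sub_dotProduct, smul_dotProduct,
    dotProduct_add, dotProduct_sub, dotProduct_smul, smul_eq_mul]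
  linear_combination (2 * (star x ⬝ᵥ A *ᵥ y) - 2 * (star y ⬝ᵥ A *ᵥ x)) * Complex.I_sq

theorem star_smul_dotProduct_mulVec_smul (A : Matrix n n ℂ) (c : ℂ) (v : n → ℂ) :
    star (c • v) ⬝ᵥ A *ᵥ (c • v) = star c * c * (star v ⬝ᵥ A *ᵥ v) := by
  simp only [star_smul, Matrix.mulVec_smul, smul_dotProduct, dotProduct_smul, smul_eq_mul]
  ring

theorem exists_smul_eq_of_ne_zero {v : n → ℂ} (hv : v ≠ 0) :
    ∃ (c : ℂ) (u : n → ℂ), star u ⬝ᵥ u = 1 ∧ c • u = v := by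
  set r := ‖WithLp.toLp 2 v‖
  have hr : (r : ℂ) ≠ 0 := by simpa [r] using hv
  have hvv : star v ⬝ᵥ v = (r : ℂ) ^ 2 := by
    rw [dotProduct_comm, ← EuclideanSpace.inner_toLp_toLp, inner_self_eq_norm_sq_to_K]
    rfl
  refine ⟨r, (r : ℂ)⁻¹ • v, ?_, smul_inv_smul₀ hr v⟩
  rw [star_smul, smul_dotProduct, dotProduct_smul, hvv]
  simp
  field_simp

variable {Ω α : Type*} [MeasurableSpace Ω] {μ : Measure Ω} {l : Filter α}
  {A : α → Ω → Matrix n n ℂ}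

theorem ae_tendsto_zero_of_star_dotProduct_mulVec
    (hA : ∀ v, star v ⬝ᵥ v = 1 → ∀ᵐ ω ∂μ, Tendsto (fun p => star v ⬝ᵥ A p ω *ᵥ v) l (𝓝 0)) :
    ∀ᵐ ω ∂μ, Tendsto (fun p => A p ω) l (𝓝 0) := by
  classical
  have hform (v : n → ℂ) : ∀ᵐ ω ∂μ, Tendsto (fun p => star v ⬝ᵥ A p ω *ᵥ v) l (𝓝 0) := by
    rcases eq_or_ne v 0 with rfl | hv
    · simpa using .of_forall fun _ => tendsto_const_nhds
    · obtain ⟨c, u, hu, rfl⟩ := exists_smul_eq_of_ne_zero hv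
      filter_upwards [hA u hu] with ω hω
      simpa only [star_smul_dotProduct_mulVec_smul, mul_zero] using hω.const_mul (star c * c)
  have hentry (i j : n) : ∀ᵐ ω ∂μ, Tendsto (fun p => A p ω i j) l (𝓝 0) := by
    set x : n → ℂ := Pi.single i 1
    set y : n → ℂ := Pi.single j 1
    filter_upwards [hform (x + y), hform (x - y), hform (x + Complex.I • y),
      hform (x - Complex.I • y)] with ω h₁ h₂ h₃ h₄
    have hlim := (((h₁.sub h₂).sub (h₃.const_mul Complex.I)).add (h₄.const_mul Complex.I)).const_mul
      (4⁻¹ : ℂ)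
    simp_rw [← four_mul_star_dotProduct_mulVec] at hlim
    simpa [x, y, Pi.star_single] using hlim
  filter_upwards [ae_all_iff.2 fun i => ae_all_iff.2 (hentry i)] with ω hω
  exact tendsto_pi_nhds.2 fun i => tendsto_pi_nhds.2 (hω i)

end Polarization

section Regime

/-- The growth conditions on the sample size `N` and the smoothing span `B` under which the
smoothed periodogram is uniformly consistent; unlike `HighDimRegime` they do not involve the
dimension of the signal. -/
structure SmoothingRegime (N B : ℕ → ℕ) : Prop where
  even_span : ∀ M, 1 ≤ M → Even (B M)
  tendsto_sampleSize : Tendsto N atTop atTop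
  summable_inv_sampleSize : Summable fun M => (N M : ℝ)⁻¹
  log_isLittleO : (fun M => Real.log (N M)) =o[atTop] fun M => (B M : ℝ)
  span_isLittleO : (fun M => (B M : ℝ)) =o[atTop] fun M => (N M : ℝ)

variable {N B : ℕ → ℕ}

namespace HighDimRegime

theorem dim_isBigO_span (h : HighDimRegime N B) :
    (fun M : ℕ => (M : ℝ)) =O[atTop] fun M => (B M : ℝ) := by
  obtain ⟨c, hc, hlim⟩ := h.ratio
  refine isBigO_of_div_tendsto_nhds ?_ c hlim
  filter_upwards [hlim.eventually_const_lt hc.1] with M hM hB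
  simp [hB] at hM

theorem span_isBigO_dim (h : HighDimRegime N B) :
    (fun M => (B M : ℝ)) =O[atTop] fun M : ℕ => (M : ℝ) := by
  obtain ⟨c, hc, hlim⟩ := h.ratio
  exact isBigO_of_div_tendsto_nhds_of_ne_zero hlim hc.1.ne'

theorem exists_rpow_dim_isBigO_sampleSize (h : HighDimRegime N B) :
    ∃ p > (1 : ℝ), (fun M : ℕ => (M : ℝ) ^ p) =O[atTop] fun M => (N M : ℝ) := by
  obtain ⟨α, hα, hO⟩ := h.dim_isBigO
  refine ⟨α⁻¹, (one_lt_inv₀ hα.1).2 hα.2, ?_⟩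
  refine (hO.rpow (inv_nonneg.2 hα.1.le) (.of_forall fun M => by positivity)).congr_right ?_
  exact fun M => Real.rpow_rpow_inv (Nat.cast_nonneg _) hα.1.ne'

theorem dim_isLittleO_sampleSize (h : HighDimRegime N B) :
    (fun M : ℕ => (M : ℝ)) =o[atTop] fun M => (N M : ℝ) := by
  obtain ⟨p, hp, hO⟩ := h.exists_rpow_dim_isBigO_sampleSize
  refine IsLittleO.trans_isBigO ?_ hO
  rw [isLittleO_iff_tendsto' ((eventually_gt_atTop 0).mono fun M hM h0 =>
    absurd h0 (Real.rpow_pos_of_pos (Nat.cast_pos.2 hM) p).ne')]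
  refine ((tendsto_rpow_neg_atTop (sub_pos.2 hp)).comp tendsto_natCast_atTop_atTop).congr' ?_
  filter_upwards [eventually_gt_atTop 0] with M hM
  rw [Function.comp_apply, neg_sub, Real.rpow_sub (Nat.cast_pos.2 hM), Real.rpow_one]

theorem tendsto_sampleSize (h : HighDimRegime N B) : Tendsto N atTop atTop := by
  have hone : (fun _ : ℕ => (1 : ℝ)) =o[atTop] fun M : ℕ => (M : ℝ) :=
    (isLittleO_one_left_iff ℝ).2 (by simpa using tendsto_natCast_atTop_atTop)
  have := (isLittleO_one_left_iff ℝ).1 (hone.trans h.dim_isLittleO_sampleSize)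
  exact tendsto_natCast_atTop_iff.1 (by simpa using this)

theorem summable_inv_sampleSize (h : HighDimRegime N B) :
    Summable fun M => (N M : ℝ)⁻¹ := by
  obtain ⟨p, hp, hO⟩ := h.exists_rpow_dim_isBigO_sampleSize
  refine summable_of_isBigO_nat (Real.summable_nat_rpow_inv.2 hp) (hO.inv_rev ?_)
  filter_upwards [eventually_gt_atTop 0] with M hM h0
  exact absurd h0 (Real.rpow_pos_of_pos (Nat.cast_pos.2 hM) p).ne'

theorem smoothingRegime (h : HighDimRegime N B) : SmoothingRegime N B where
  even_span := h.even_span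
  tendsto_sampleSize := h.tendsto_sampleSize
  summable_inv_sampleSize := h.summable_inv_sampleSize
  log_isLittleO := h.log_isLittleO.trans_isBigO h.dim_isBigO_span
  span_isLittleO := h.span_isBigO_dim.trans_isLittleO h.dim_isLittleO_sampleSize

end HighDimRegime

namespace SmoothingRegime

theorem eventually_span_lt (h : SmoothingRegime N B) : ∀ᶠ M in atTop, B M < N M := by
  filter_upwards [h.span_isLittleO.def one_half_pos, h.tendsto_sampleSize.eventually_gt_atTop 0]
    with M hM hN
  have hN' : (0 : ℝ) < N M := Nat.cast_pos.2 hN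
  simp only [Real.norm_natCast] at hM
  exact_mod_cast (show (B M : ℝ) < N M by linarith)

theorem tendsto_span_div_sampleSize (h : SmoothingRegime N B) :
    Tendsto (fun M => (B M : ℝ) / N M) atTop (𝓝 0) :=
  h.span_isLittleO.tendsto_div_nhds_zero

theorem eventually_mul_exp_le_inv (h : SmoothingRegime N B) {c : ℝ} (hc : 0 < c) :
    ∀ᶠ M in atTop, (N M : ℝ) * Real.exp (-c * (B M + 1)) ≤ (N M : ℝ)⁻¹ := by
  filter_upwards [h.log_isLittleO.def (half_pos hc), h.tendsto_sampleSize.eventually_gt_atTop 0]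
    with M hlog hN
  have hN' : (0 : ℝ) < N M := Nat.cast_pos.2 hN
  have hlog' : Real.log (N M) ≤ c / 2 * B M := by
    simpa using (le_abs_self _).trans hlog
  calc (N M : ℝ) * Real.exp (-c * (B M + 1))
      = Real.exp (Real.log (N M) + -c * (B M + 1)) := by rw [Real.exp_add, Real.exp_log hN']
    _ ≤ Real.exp (-Real.log (N M)) := Real.exp_le_exp.2 (by linarith)
    _ = (N M : ℝ)⁻¹ := by rw [Real.exp_neg, Real.exp_log hN']

end SmoothingRegime

end Regime

section NoisePeriodogram

variable {Ω : Type*} [MeasurableSpace Ω] {μ : Measure Ω} {K : ℕ}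
  {ε : ℕ → ℤ → Ω → Fin K → ℂ} {N B : ℕ → ℕ}

theorem ae_tendsto_star_dotProduct_smoothedPeriodogram_sub_one [IsFiniteMeasure μ]
    (h : SmoothingRegime N B)
    (hε : ∀ M, 1 ≤ M → IsComplexGaussianWhiteNoise (ε M) μ) {v : Fin K → ℂ}
    (hv : star v ⬝ᵥ v = 1) :
    ∀ᵐ ω ∂μ, Tendsto (fun p : Σ M, Fin (N M) => star v ⬝ᵥ
      (smoothedPeriodogram (N p.1) (B p.1) (fun n => ε p.1 n ω) ((p.2 : ℝ) / N p.1) - 1) *ᵥ v)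
        (uniformAtTop fun M => Fin (N M)) (𝓝 0) := by
  refine ae_tendsto_uniformAtTop (h.summable_inv_sampleSize.mul_left 2) fun δ hδ hδ1 => ?_
  filter_upwards [h.eventually_span_lt,
    h.eventually_mul_exp_le_inv (c := δ ^ 2 / 8) (by positivity),
    eventually_ge_atTop 1] with M hBN hexp hM
  refine (Finset.sum_le_card_nsmul _ _ _ fun k _ => (hε M hM).measureReal_le_norm_star_dotProduct_le
    (h.even_span M hM) hBN hv _ hδ.le hδ1).trans ?_
  rw [Finset.card_univ, Fintype.card_fin, nsmul_eq_mul]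
  linarith

theorem ae_tendsto_smoothedPeriodogram_sub_one [IsFiniteMeasure μ] (h : SmoothingRegime N B)
    (hε : ∀ M, 1 ≤ M → IsComplexGaussianWhiteNoise (ε M) μ) :
    ∀ᵐ ω ∂μ, Tendsto (fun p : Σ M, Fin (N M) =>
      smoothedPeriodogram (N p.1) (B p.1) (fun n => ε p.1 n ω) ((p.2 : ℝ) / N p.1) - 1)
        (uniformAtTop fun M => Fin (N M)) (𝓝 0) :=
  ae_tendsto_zero_of_star_dotProduct_mulVec fun _ hv =>
    ae_tendsto_star_dotProduct_smoothedPeriodogram_sub_one h hε hv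

end NoisePeriodogram

section TransferFunction

variable {M K : ℕ} {H : ℤ → Matrix (Fin M) (Fin K) ℂ}

theorem norm_exp_neg_two_pi_mul (ν : ℝ) (k : ℤ) :
    ‖Complex.exp (-(2 * (Real.pi : ℂ) * Complex.I * (ν : ℂ) * (k : ℂ)))‖ = 1 := by
  rw [show -(2 * (Real.pi : ℂ) * Complex.I * (ν : ℂ) * (k : ℂ)) =
    ((-(2 * Real.pi * ν * k) : ℝ) : ℂ) * Complex.I by push_cast; ring]
  exact Complex.norm_exp_ofReal_mul_I _

theorem norm_exp_neg_two_pi_mul_sub_le (ν ν' : ℝ) (k : ℤ) :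
    ‖Complex.exp (-(2 * (Real.pi : ℂ) * Complex.I * (ν : ℂ) * (k : ℂ))) -
      Complex.exp (-(2 * (Real.pi : ℂ) * Complex.I * (ν' : ℂ) * (k : ℂ)))‖ ≤
      2 * Real.pi * |ν - ν'| * |(k : ℝ)| := by
  have hfactor : Complex.exp (-(2 * (Real.pi : ℂ) * Complex.I * (ν : ℂ) * (k : ℂ))) -
      Complex.exp (-(2 * (Real.pi : ℂ) * Complex.I * (ν' : ℂ) * (k : ℂ))) =
      Complex.exp (-(2 * (Real.pi : ℂ) * Complex.I * (ν' : ℂ) * (k : ℂ))) *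
        (Complex.exp (Complex.I * ((-(2 * Real.pi * (ν - ν') * k) : ℝ) : ℂ)) - 1) := by
    rw [mul_sub, ← Complex.exp_add, mul_one]
    congr 2
    push_cast
    ring
  rw [hfactor, norm_mul, norm_exp_neg_two_pi_mul, one_mul]
  refine Real.norm_exp_I_mul_ofReal_sub_one_le.trans_eq ?_
  rw [Real.norm_eq_abs, abs_neg, abs_mul, abs_mul, abs_of_pos Real.two_pi_pos]

theorem summable_norm_of_summable_memory (hH : Summable fun k : ℤ => (1 + |(k : ℝ)|) * ‖H k‖) :
    Summable fun k => ‖H k‖ :=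
  hH.of_nonneg_of_le (fun _ => norm_nonneg _) fun _ =>
    le_mul_of_one_le_left (norm_nonneg _) (le_add_of_nonneg_right (abs_nonneg _))

theorem hasSum_transferFunction (hH : Summable fun k => ‖H k‖) (ν : ℝ) :
    HasSum (fun k : ℤ => Complex.exp (-(2 * (Real.pi : ℂ) * Complex.I * (ν : ℂ) * (k : ℂ))) • H k)
      (transferFunction H ν) :=
  (Summable.of_norm (hH.congr fun k => by
    rw [norm_smul, norm_exp_neg_two_pi_mul, one_mul])).hasSum

theorem norm_transferFunction_le (hH : Summable fun k : ℤ => (1 + |(k : ℝ)|) * ‖H k‖) (ν : ℝ) :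
    ‖transferFunction H ν‖ ≤ ∑' k : ℤ, (1 + |(k : ℝ)|) * ‖H k‖ := by
  refine (hasSum_transferFunction (summable_norm_of_summable_memory hH) ν).norm_le_of_bounded
    hH.hasSum fun k => ?_
  rw [norm_smul, norm_exp_neg_two_pi_mul]
  gcongr
  exact le_add_of_nonneg_right (abs_nonneg _)

theorem norm_transferFunction_sub_le (hH : Summable fun k : ℤ => (1 + |(k : ℝ)|) * ‖H k‖)
    (ν ν' : ℝ) : ‖transferFunction H ν - transferFunction H ν'‖ ≤
      2 * Real.pi * |ν - ν'| * ∑' k : ℤ, (1 + |(k : ℝ)|) * ‖H k‖ := by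
  have hs := summable_norm_of_summable_memory hH
  refine ((hasSum_transferFunction hs ν).sub (hasSum_transferFunction hs ν')).norm_le_of_bounded
    (hH.hasSum.mul_left _) fun k => ?_
  rw [← sub_smul, norm_smul, ← mul_assoc]
  gcongr
  refine (norm_exp_neg_two_pi_mul_sub_le ν ν' k).trans ?_
  gcongr
  exact le_add_of_nonneg_left zero_le_one

theorem hasSum_transferFunction_mulVec (hH : Summable fun k => ‖H k‖) (ν : ℝ) (z : Fin K → ℂ) :
    HasSum (fun k : ℤ => H k *ᵥ
      (Complex.exp (-(2 * (Real.pi : ℂ) * Complex.I * (ν : ℂ) * (k : ℂ))) • z))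
      (transferFunction H ν *ᵥ z) := by
  have hmap := (hasSum_transferFunction hH ν).map
    ((Matrix.mulVecBilin ℂ ℂ (m := Fin M) (n := Fin K)).flip z)
    (continuous_id.matrix_mulVec continuous_const)
  refine hmap.congr_fun fun k => ?_
  simp [Function.comp_apply, Matrix.mulVec_smul]

end TransferFunction

section BoundaryEffect

/-- The indices that belong to exactly one of the windows `[-k, N - k)` and `[0, N)`: the samples
by which a delay of `k` changes a sum over `N` consecutive times. -/
noncomputable def shiftBoundary (N : ℕ) (k : ℤ) : Finset ℤ :=
  symmDiff (Finset.Ico (-k) (N - k)) (Finset.Ico 0 (N : ℤ))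

theorem card_shiftBoundary_le (N : ℕ) (k : ℤ) : (shiftBoundary N k).card ≤ 2 * k.natAbs := by
  have hsub : shiftBoundary N k ⊆
      (Finset.Ico (-k) 0 ∪ Finset.Ico (N - k) (N : ℤ)) ∪
        (Finset.Ico 0 (-k) ∪ Finset.Ico (N : ℤ) (N - k)) := by
    intro m hm
    simp only [shiftBoundary, Finset.mem_symmDiff, Finset.mem_Ico, Finset.mem_union] at hm ⊢
    omega
  refine (Finset.card_le_card hsub).trans ((Finset.card_union_le _ _).trans
    ((add_le_add (Finset.card_union_le _ _) (Finset.card_union_le _ _)).trans ?_))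
  simp only [Int.card_Ico]
  omega

theorem sum_range_sub_eq_sum_Ico {E : Type*} [AddCommMonoid E] (N : ℕ) (k : ℤ) (f : ℤ → E) :
    ∑ n ∈ Finset.range N, f (n - k) = ∑ m ∈ Finset.Ico (-k) (N - k), f m := by
  refine Finset.sum_nbij' (fun n => (n : ℤ) - k) (fun m => (m + k).toNat) ?_ ?_ ?_ ?_ ?_ <;>
    simp only [Finset.mem_range, Finset.mem_Ico, implies_true] <;> omega

theorem norm_sum_sub_sum_le_sum_symmDiff {ι E : Type*} [DecidableEq ι] [SeminormedAddCommGroup E]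
    (s t : Finset ι) (f : ι → E) :
    ‖∑ i ∈ s, f i - ∑ i ∈ t, f i‖ ≤ ∑ i ∈ symmDiff s t, ‖f i‖ := by
  rw [← Finset.sum_sdiff_sub_sum_sdiff, symmDiff_def, Finset.sup_eq_union,
    Finset.sum_union disjoint_sdiff_sdiff]
  exact (norm_sub_le _ _).trans (add_le_add (norm_sum_le _ _) (norm_sum_le _ _))

theorem norm_sum_range_sub_sum_range_le {E : Type*} [SeminormedAddCommGroup E] (N : ℕ) (k : ℤ)
    (f : ℤ → E) : ‖∑ n ∈ Finset.range N, f (n - k) - ∑ n ∈ Finset.range N, f n‖ ≤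
      ∑ m ∈ shiftBoundary N k, ‖f m‖ := by
  have hzero := sum_range_sub_eq_sum_Ico N 0 f
  simp only [sub_zero, neg_zero] at hzero
  rw [sum_range_sub_eq_sum_Ico, hzero]
  exact norm_sum_sub_sum_le_sum_symmDiff _ _ _

variable {M K : ℕ} {H : ℤ → Matrix (Fin M) (Fin K) ℂ}

theorem hasSum_finiteFourier {ι : Type*} {f : ι → ℤ → Fin K → ℂ} {y : ℤ → Fin K → ℂ}
    (hf : ∀ n, HasSum (fun k => f k n) (y n)) (N : ℕ) (ν : ℝ) :
    HasSum (fun k => finiteFourier N (f k) ν) (finiteFourier N y ν) :=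
  HasSum.const_smul _ (hasSum_sum fun n _ => (hf n).const_smul _)

theorem finiteFourier_mulVec (A : Matrix (Fin M) (Fin K) ℂ) (N : ℕ) (x : ℤ → Fin K → ℂ) (ν : ℝ) :
    finiteFourier N (fun n => A *ᵥ x n) ν = A *ᵥ finiteFourier N x ν := by
  simp only [finiteFourier, Matrix.mulVec_smul, Matrix.mulVec_sum]

theorem toLp_finiteFourier (N : ℕ) (x : ℤ → Fin K → ℂ) (ν : ℝ) :
    WithLp.toLp 2 (finiteFourier N x ν) = (1 / (Real.sqrt (N : ℝ) : ℂ)) • ∑ n ∈ Finset.range N,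
      Complex.exp (-(2 * (Real.pi : ℂ) * Complex.I * (ν : ℂ) * ((n : ℤ) : ℂ))) •
        WithLp.toLp 2 (x n) := by
  simp only [finiteFourier, WithLp.toLp_smul, WithLp.toLp_sum, Int.cast_natCast]
  congr! 5
  ring

theorem norm_finiteFourier_shift_sub_le (N : ℕ) (k : ℤ) (x : ℤ → Fin K → ℂ) (ν : ℝ) :
    ‖WithLp.toLp 2 (finiteFourier N (fun n => x (n - k)) ν -
      Complex.exp (-(2 * (Real.pi : ℂ) * Complex.I * (ν : ℂ) * (k : ℂ))) • finiteFourier N x ν)‖ ≤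
      (√(N : ℝ))⁻¹ * ∑ m ∈ shiftBoundary N k, ‖WithLp.toLp 2 (x m)‖ := by
  set e : ℤ → ℂ := fun n => Complex.exp (-(2 * (Real.pi : ℂ) * Complex.I * (ν : ℂ) * (n : ℂ)))
    with he
  have hphase (n : ℤ) : e n = e k * e (n - k) := by
    simp only [he, ← Complex.exp_add]
    congr 1
    push_cast
    ring
  have hfactor : WithLp.toLp 2 (finiteFourier N (fun n => x (n - k)) ν - e k • finiteFourier N x ν)
      = (1 / (Real.sqrt (N : ℝ) : ℂ) * e k) •
        (∑ n ∈ Finset.range N, e (n - k) • WithLp.toLp 2 (x (n - k)) -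
          ∑ n ∈ Finset.range N, e n • WithLp.toLp 2 (x n)) := by
    rw [WithLp.toLp_sub, WithLp.toLp_smul, toLp_finiteFourier, toLp_finiteFourier, smul_sub,
      mul_smul, mul_smul, smul_comm (e k)]
    congr 2
    rw [Finset.smul_sum]
    exact Finset.sum_congr rfl fun n _ => by rw [smul_smul, ← hphase]
  rw [hfactor, norm_smul, norm_mul, norm_exp_neg_two_pi_mul, mul_one, norm_div, norm_one,
    Complex.norm_of_nonneg (Real.sqrt_nonneg _), one_div]
  gcongr
  refine (norm_sum_range_sub_sum_range_le N k fun n => e n • WithLp.toLp 2 (x n)).trans_eq ?_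
  exact Finset.sum_congr rfl fun m _ => by rw [norm_smul, norm_exp_neg_two_pi_mul, one_mul]

/-- The boundary effect of the filter `H` on the input `x`: up to a factor `N^{-1/2}`, it bounds
the error in exchanging the filter with the finite Fourier transform, uniformly in the
frequency. It is `⊤` where the series diverges. -/
noncomputable def boundaryEffect (H : ℤ → Matrix (Fin M) (Fin K) ℂ) (N : ℕ)
    (x : ℤ → Fin K → ℂ) : ENNReal :=
  ∑' k : ℤ, ‖H k‖ₑ * ∑ m ∈ shiftBoundary N k, ‖WithLp.toLp 2 (x m)‖ₑ

theorem enorm_finiteFourier_sub_transferFunction_mulVec_le (hH : Summable fun k => ‖H k‖)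
    {x : ℤ → Fin K → ℂ} {y : ℤ → Fin M → ℂ}
    (hy : ∀ n, HasSum (fun k : ℤ => H k *ᵥ x (n - k)) (y n)) (N : ℕ) (ν : ℝ) :
    ‖WithLp.toLp 2 (finiteFourier N y ν - transferFunction H ν *ᵥ finiteFourier N x ν)‖ₑ ≤
      ENNReal.ofReal (√(N : ℝ))⁻¹ * boundaryEffect H N x := by
  have hsum : HasSum (fun k : ℤ => WithLp.toLp 2 (H k *ᵥ (finiteFourier N (fun n => x (n - k)) ν -
      Complex.exp (-(2 * (Real.pi : ℂ) * Complex.I * (ν : ℂ) * (k : ℂ))) • finiteFourier N x ν)))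
      (WithLp.toLp 2 (finiteFourier N y ν - transferFunction H ν *ᵥ finiteFourier N x ν)) := by
    have hdiff := (hasSum_finiteFourier hy N ν).sub
      (hasSum_transferFunction_mulVec hH ν (finiteFourier N x ν))
    simp only [finiteFourier_mulVec _ N (fun n => x (n - _)), ← Matrix.mulVec_sub] at hdiff
    exact hdiff.map (WithLp.linearEquiv 2 ℂ (Fin M → ℂ)).symm
      (PiLp.continuous_toLp 2 fun _ : Fin M => ℂ)
  rw [← hsum.tsum_eq, boundaryEffect, ← ENNReal.tsum_mul_left]
  refine enorm_tsum_le_tsum_enorm.trans (ENNReal.tsum_le_tsum fun k => ?_)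
  simp_rw [← ofReal_norm]
  rw [← ENNReal.ofReal_sum_of_nonneg fun _ _ => norm_nonneg _, ← ENNReal.ofReal_mul (by positivity),
    ← ENNReal.ofReal_mul (by positivity)]
  refine ENNReal.ofReal_le_ofReal (((H k).l2_opNorm_mulVec (WithLp.toLp 2 _)).trans ?_)
  rw [mul_left_comm]
  gcongr
  exact norm_finiteFourier_shift_sub_le N k x ν

end BoundaryEffect

section BoundaryMoment

variable {Ω : Type*} [MeasurableSpace Ω] {μ : Measure Ω}

theorem lintegral_mul_le_of_lintegral_sq_le {f g : Ω → ENNReal} (hf : AEMeasurable f μ)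
    (hg : AEMeasurable g μ) {V : ENNReal} (hfV : ∫⁻ ω, f ω ^ 2 ∂μ ≤ V)
    (hgV : ∫⁻ ω, g ω ^ 2 ∂μ ≤ V) : ∫⁻ ω, f ω * g ω ∂μ ≤ V := by
  have hholder := ENNReal.lintegral_mul_le_Lp_mul_Lq μ Real.HolderConjugate.two_two hf hg
  simp only [Pi.mul_apply, ENNReal.rpow_two] at hholder
  calc ∫⁻ ω, f ω * g ω ∂μ
      ≤ (∫⁻ ω, f ω ^ 2 ∂μ) ^ (1 / 2 : ℝ) * (∫⁻ ω, g ω ^ 2 ∂μ) ^ (1 / 2 : ℝ) := hholder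
    _ ≤ V ^ (1 / 2 : ℝ) * V ^ (1 / 2 : ℝ) := by gcongr
    _ = V := by rw [← ENNReal.rpow_add_of_nonneg _ _ (by simp) (by simp), add_halves,
        ENNReal.rpow_one]

theorem lintegral_tsum_mul_sq_le {ι : Type*} [Countable ι] (a : ι → ENNReal) {f : ι → Ω → ENNReal}
    (hf : ∀ i, AEMeasurable (f i) μ) {V : ENNReal} (hV : ∀ i, ∫⁻ ω, f i ω ^ 2 ∂μ ≤ V) :
    ∫⁻ ω, (∑' i, a i * f i ω) ^ 2 ∂μ ≤ (∑' i, a i) ^ 2 * V := by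
  have hexpand (ω : Ω) : (∑' i, a i * f i ω) ^ 2 = ∑' i, ∑' j, a i * a j * (f i ω * f j ω) := by
    rw [pow_two, ← ENNReal.tsum_mul_right]
    simp_rw [← ENNReal.tsum_mul_left, mul_mul_mul_comm (a _) (f _ ω)]
  have hm (i j : ι) : AEMeasurable (fun ω => f i ω * f j ω) μ := (hf i).mul (hf j)
  simp_rw [hexpand]
  rw [lintegral_tsum fun i => AEMeasurable.tsum fun j => (hm i j).const_mul _]
  calc ∑' i, ∫⁻ ω, ∑' j, a i * a j * (f i ω * f j ω) ∂μ
      = ∑' i, ∑' j, a i * a j * ∫⁻ ω, f i ω * f j ω ∂μ := by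
        refine tsum_congr fun i => ?_
        rw [lintegral_tsum fun j => (hm i j).const_mul _]
        simp_rw [lintegral_const_mul'' _ (hm i _)]
    _ ≤ ∑' i, ∑' j, a i * a j * V := by
        gcongr with i j
        exact lintegral_mul_le_of_lintegral_sq_le (hf i) (hf j) (hV i) (hV j)
    _ = (∑' i, a i) ^ 2 * V := by
        simp_rw [ENNReal.tsum_mul_right, ENNReal.tsum_mul_left, ENNReal.tsum_mul_right, pow_two]

theorem ae_tendsto_zero_of_tsum_lintegral_ne_top {f : ℕ → Ω → ENNReal}
    (hf : ∀ n, AEMeasurable (f n) μ) (hs : ∑' n, ∫⁻ ω, f n ω ∂μ ≠ ⊤) :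
    ∀ᵐ ω ∂μ, Tendsto (fun n => f n ω) atTop (𝓝 0) := by
  rw [← lintegral_tsum hf] at hs
  filter_upwards [ae_lt_top' (AEMeasurable.tsum hf) hs] with ω hω
  exact ENNReal.tendsto_atTop_zero_of_tsum_ne_top hω.ne

variable {M K : ℕ} {H : ℤ → Matrix (Fin M) (Fin K) ℂ} {ε : ℤ → Ω → Fin K → ℂ}

/-- The total weight with which the filter `H` lets the sample at time `m` enter the boundary
effect. -/
noncomputable def boundaryWeight (H : ℤ → Matrix (Fin M) (Fin K) ℂ) (N : ℕ) (m : ℤ) : ENNReal :=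
  ∑' k : ℤ, if m ∈ shiftBoundary N k then ‖H k‖ₑ else 0

theorem boundaryEffect_eq_tsum_boundaryWeight_mul (N : ℕ) (x : ℤ → Fin K → ℂ) :
    boundaryEffect H N x = ∑' m, boundaryWeight H N m * ‖WithLp.toLp 2 (x m)‖ₑ := by
  simp_rw [boundaryWeight, ← ENNReal.tsum_mul_right]
  rw [ENNReal.tsum_comm, boundaryEffect]
  refine tsum_congr fun k => ?_
  simp_rw [ite_mul, zero_mul]
  rw [Finset.mul_sum, tsum_eq_sum (s := shiftBoundary N k) fun m hm => if_neg hm]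
  exact Finset.sum_congr rfl fun m hm => (if_pos hm).symm

theorem tsum_boundaryWeight_le (hH : Summable fun k : ℤ => (1 + |(k : ℝ)|) * ‖H k‖) (N : ℕ) :
    ∑' m, boundaryWeight H N m ≤
      ENNReal.ofReal (2 * ∑' k : ℤ, (1 + |(k : ℝ)|) * ‖H k‖) := by
  simp_rw [boundaryWeight]
  rw [ENNReal.tsum_comm, ← tsum_mul_left, ENNReal.ofReal_tsum_of_nonneg (fun k => by positivity)
    (hH.mul_left 2)]
  refine ENNReal.tsum_le_tsum fun k => ?_
  rw [tsum_eq_sum (s := shiftBoundary N k) fun m hm => if_neg hm,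
    Finset.sum_congr rfl fun m hm => if_pos hm, Finset.sum_const, nsmul_eq_mul, ← ofReal_norm,
    ← ENNReal.ofReal_natCast, ← ENNReal.ofReal_mul (Nat.cast_nonneg _), ← mul_assoc]
  gcongr
  calc ((shiftBoundary N k).card : ℝ) ≤ ((2 * k.natAbs : ℕ) : ℝ) := by
        exact_mod_cast card_shiftBoundary_le N k
    _ = 2 * |(k : ℝ)| := by rw [Nat.cast_mul, Nat.cast_natAbs, Int.cast_abs, Nat.cast_two]
    _ ≤ 2 * (1 + |(k : ℝ)|) := by gcongr; exact le_add_of_nonneg_left zero_le_one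

theorem IsComplexGaussianWhiteNoise.aemeasurable_enorm (hε : IsComplexGaussianWhiteNoise ε μ)
    (n : ℤ) : AEMeasurable (fun ω => ‖WithLp.toLp 2 (ε n ω)‖ₑ) μ :=
  ((PiLp.continuous_toLp 2 fun _ : Fin K => ℂ).measurable.comp_aemeasurable
    (aemeasurable_pi_lambda _ fun i => (hε.law n i).aemeasurable)).enorm

theorem IsComplexGaussianWhiteNoise.lintegral_enorm_sq (hε : IsComplexGaussianWhiteNoise ε μ)
    (n : ℤ) : ∫⁻ ω, ‖WithLp.toLp 2 (ε n ω)‖ₑ ^ 2 ∂μ = K := by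
  have hsq (ω : Ω) : ‖WithLp.toLp 2 (ε n ω)‖ₑ ^ 2 = ∑ i, ENNReal.ofReal (‖ε n ω i‖ ^ 2) := by
    rw [← ofReal_norm, ← ENNReal.ofReal_pow (norm_nonneg _), EuclideanSpace.norm_sq_eq,
      ENNReal.ofReal_sum_of_nonneg fun _ _ => sq_nonneg _]
  have hint (i : Fin K) : Integrable (fun ω => ‖ε n ω i‖ ^ 2) μ :=
    hε.isWhiteFamily.integrable_norm_sq (n, i)
  simp_rw [hsq]
  rw [lintegral_finsetSum' _ fun i _ => (hint i).1.aemeasurable.ennreal_ofReal]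
  simp_rw [← ofReal_integral_eq_lintegral_ofReal (hint _) (ae_of_all _ fun _ => sq_nonneg _),
    fun i => hε.isWhiteFamily.integral_norm_sq (n, i)]
  simp

theorem IsComplexGaussianWhiteNoise.aemeasurable_boundaryEffect
    (hε : IsComplexGaussianWhiteNoise ε μ) (N : ℕ) :
    AEMeasurable (fun ω => boundaryEffect H N fun n => ε n ω) μ :=
  AEMeasurable.tsum fun _ =>
    (Finset.aemeasurable_fun_sum _ fun m _ => hε.aemeasurable_enorm m).const_mul _

theorem IsComplexGaussianWhiteNoise.lintegral_boundaryEffect_sq_le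
    (hε : IsComplexGaussianWhiteNoise ε μ) (hH : Summable fun k : ℤ => (1 + |(k : ℝ)|) * ‖H k‖)
    (N : ℕ) : ∫⁻ ω, boundaryEffect H N (fun n => ε n ω) ^ 2 ∂μ ≤
      ENNReal.ofReal (2 * ∑' k : ℤ, (1 + |(k : ℝ)|) * ‖H k‖) ^ 2 * K := by
  simp_rw [boundaryEffect_eq_tsum_boundaryWeight_mul]
  refine (lintegral_tsum_mul_sq_le _ hε.aemeasurable_enorm
    fun n => (hε.lintegral_enorm_sq n).le).trans ?_
  gcongr
  exact tsum_boundaryWeight_le hH N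

end BoundaryMoment

section BoundaryLimit

variable {Ω : Type*} [MeasurableSpace Ω] {μ : Measure Ω} {K : ℕ} {d N : ℕ → ℕ}
  {H : (M : ℕ) → ℤ → Matrix (Fin (d M)) (Fin K) ℂ} {ε : ℕ → ℤ → Ω → Fin K → ℂ} {C : ℝ}

theorem ae_tendsto_boundaryEffect (hN : Summable fun M => (N M : ℝ)⁻¹)
    (hH : ∀ M, 1 ≤ M → Summable (fun k : ℤ => (1 + |(k : ℝ)|) * ‖H M k‖) ∧
      ∑' k : ℤ, (1 + |(k : ℝ)|) * ‖H M k‖ ≤ C)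
    (hε : ∀ M, 1 ≤ M → IsComplexGaussianWhiteNoise (ε M) μ) :
    ∀ᵐ ω ∂μ, Tendsto (fun M => ENNReal.ofReal (√(N M : ℝ))⁻¹ *
      boundaryEffect (H M) (N M) fun n => ε M n ω) atTop (𝓝 0) := by
  set f : ℕ → Ω → ENNReal := fun M ω =>
    ENNReal.ofReal (√(N M : ℝ))⁻¹ * boundaryEffect (H M) (N M) fun n => ε M n ω with hf
  have hmeas (M : ℕ) : AEMeasurable (fun ω => f (M + 1) ω ^ 2) μ :=
    (((hε (M + 1) M.succ_pos).aemeasurable_boundaryEffect _).const_mul _).pow_const 2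
  have hbound (M : ℕ) : ∫⁻ ω, f (M + 1) ω ^ 2 ∂μ ≤
      ENNReal.ofReal (N (M + 1) : ℝ)⁻¹ * (ENNReal.ofReal (2 * C) ^ 2 * K) := by
    have hε' := hε (M + 1) M.succ_pos
    simp_rw [hf, mul_pow, ← ENNReal.ofReal_pow (inv_nonneg.2 (Real.sqrt_nonneg _)), inv_pow,
      Real.sq_sqrt (Nat.cast_nonneg _)]
    rw [lintegral_const_mul'' _ ((hε'.aemeasurable_boundaryEffect _).pow_const 2)]
    gcongr
    refine (hε'.lintegral_boundaryEffect_sq_le (hH _ M.succ_pos).1 _).trans ?_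
    gcongr
    exact (hH _ M.succ_pos).2
  have hsum : ∑' M, ∫⁻ ω, f (M + 1) ω ^ 2 ∂μ ≠ ⊤ := by
    refine ne_top_of_le_ne_top ?_ (ENNReal.tsum_le_tsum hbound)
    rw [ENNReal.tsum_mul_right, ← ENNReal.ofReal_tsum_of_nonneg (fun M => by positivity)
      ((summable_nat_add_iff 1).2 hN)]
    finiteness
  filter_upwards [ae_tendsto_zero_of_tsum_lintegral_ne_top hmeas hsum] with ω hω
  rw [← tendsto_add_atTop_iff_nat 1]
  have hsqrt := hω.ennrpow_const (1 / 2)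
  rw [ENNReal.zero_rpow_of_pos (by simp)] at hsqrt
  refine hsqrt.congr fun M => ?_
  rw [← ENNReal.rpow_two, ← ENNReal.rpow_mul]
  norm_num [hf]

theorem ae_exists_tendsto_finiteFourier_sub_le (hN : Summable fun M => (N M : ℝ)⁻¹)
    (hH : ∀ M, 1 ≤ M → Summable (fun k : ℤ => (1 + |(k : ℝ)|) * ‖H M k‖) ∧
      ∑' k : ℤ, (1 + |(k : ℝ)|) * ‖H M k‖ ≤ C)
    (hε : ∀ M, 1 ≤ M → IsComplexGaussianWhiteNoise (ε M) μ)
    {u : (M : ℕ) → ℤ → Ω → Fin (d M) → ℂ}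
    (hu : ∀ M, 1 ≤ M → IsFilterOutput (H M) (ε M) (u M) μ) :
    ∀ᵐ ω ∂μ, ∃ r : ℕ → ℝ, Tendsto r atTop (𝓝 0) ∧ ∀ᶠ M in atTop, ∀ ν : ℝ,
      ‖WithLp.toLp 2 (finiteFourier (N M) (fun n => u M n ω) ν -
        transferFunction (H M) ν *ᵥ finiteFourier (N M) (fun n => ε M n ω) ν)‖ ≤ r M := by
  have hu' : ∀ᵐ ω ∂μ, ∀ M, 1 ≤ M → ∀ n : ℤ,
      HasSum (fun k : ℤ => H M k *ᵥ ε M (n - k) ω) (u M n ω) := by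
    simp_rw [ae_all_iff]
    exact fun M hM n => hu M hM n
  filter_upwards [ae_tendsto_boundaryEffect hN hH hε, hu'] with ω hlim hω
  refine ⟨fun M => (ENNReal.ofReal (√(N M : ℝ))⁻¹ *
    boundaryEffect (H M) (N M) fun n => ε M n ω).toReal,
      (ENNReal.tendsto_toReal ENNReal.zero_ne_top).comp hlim, ?_⟩
  filter_upwards [hlim.eventually_lt_const ENNReal.zero_lt_top, eventually_ge_atTop 1]
    with M hfin hM ν
  rw [← toReal_enorm]
  exact ENNReal.toReal_mono hfin.ne (enorm_finiteFourier_sub_transferFunction_mulVec_le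
    (x := fun n => ε M n ω) (summable_norm_of_summable_memory (hH M hM).1) (hω M hM) _ ν)

end BoundaryLimit

section Perturbation

theorem norm_vecMulVec_star_le {m n : ℕ} (x : Fin m → ℂ) (y : Fin n → ℂ) :
    ‖Matrix.vecMulVec x (star y)‖ ≤ ‖WithLp.toLp 2 x‖ * ‖WithLp.toLp 2 y‖ := by
  rw [Matrix.l2_opNorm_def]
  refine ContinuousLinearMap.opNorm_le_bound _ (by positivity) fun z => ?_
  change ‖WithLp.toLp 2 (Matrix.vecMulVec x (star y) *ᵥ WithLp.ofLp z)‖ ≤ _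
  have hinner : Matrix.vecMulVec x (star y) *ᵥ WithLp.ofLp z =
      (inner ℂ (WithLp.toLp 2 y) z : ℂ) • x := by
    rw [Matrix.vecMulVec_mulVec, EuclideanSpace.inner_eq_star_dotProduct, dotProduct_comm,
      op_smul_eq_smul]
  rw [hinner, WithLp.toLp_smul, norm_smul, mul_comm, mul_assoc]
  gcongr
  exact norm_inner_le_norm _ _

theorem norm_apply_le_l2_opNorm {m n : ℕ} (A : Matrix (Fin m) (Fin n) ℂ) (i : Fin m) (j : Fin n) :
    ‖A i j‖ ≤ ‖A‖ := by
  have hcol := (PiLp.norm_apply_le _ i).trans (A.l2_opNorm_mulVec (EuclideanSpace.single j 1))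
  simpa using hcol

theorem norm_trace_le {n : ℕ} (A : Matrix (Fin n) (Fin n) ℂ) : ‖A.trace‖ ≤ n * ‖A‖ := by
  refine (norm_sum_le_of_le _ fun i _ => norm_apply_le_l2_opNorm A i i).trans_eq ?_
  simp

variable {M K : ℕ}

theorem norm_vecMulVec_sub_conj_le {A : Matrix (Fin M) (Fin K) ℂ} {z : Fin K → ℂ} {w : Fin M → ℂ}
    {C δ : ℝ} (hA : ‖A‖ ≤ C) (hδ : 0 ≤ δ)
    (h : ‖WithLp.toLp 2 (w - A *ᵥ z)‖ ≤ δ * (1 + ‖WithLp.toLp 2 z‖)) :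
    ‖Matrix.vecMulVec w (star w) - A * Matrix.vecMulVec z (star z) * Aᴴ‖ ≤
      2 * δ * (2 * C + δ) * (1 + ‖WithLp.toLp 2 z‖ ^ 2) := by
  set r := w - A *ᵥ z with hr
  set q := ‖WithLp.toLp 2 z‖
  have hC : 0 ≤ C := (norm_nonneg _).trans hA
  have : 0 ≤ q := norm_nonneg _
  have hexpand : Matrix.vecMulVec w (star w) - A * Matrix.vecMulVec z (star z) * Aᴴ =
      Matrix.vecMulVec r (star (A *ᵥ z)) + Matrix.vecMulVec (A *ᵥ z) (star r) +
        Matrix.vecMulVec r (star r) := by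
    rw [Matrix.mul_vecMulVec, Matrix.vecMulVec_mul, ← Matrix.star_mulVec,
      ← sub_add_cancel w (A *ᵥ z), ← hr, star_add, Matrix.add_vecMulVec, Matrix.vecMulVec_add,
      Matrix.vecMulVec_add]
    abel
  have hAz : ‖WithLp.toLp 2 (A *ᵥ z)‖ ≤ C * (1 + q) := by
    refine (A.l2_opNorm_mulVec (WithLp.toLp 2 z)).trans ?_
    gcongr
    exact le_add_of_nonneg_left zero_le_one
  calc ‖Matrix.vecMulVec w (star w) - A * Matrix.vecMulVec z (star z) * Aᴴ‖
      ≤ δ * (1 + q) * (C * (1 + q)) + C * (1 + q) * (δ * (1 + q)) +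
          δ * (1 + q) * (δ * (1 + q)) := by
        rw [hexpand]
        refine norm_add₃_le.trans (add_le_add_three ?_ ?_ ?_) <;>
          exact (norm_vecMulVec_star_le _ _).trans (by gcongr)
    _ = δ * (2 * C + δ) * (1 + q) ^ 2 := by ring
    _ ≤ δ * (2 * C + δ) * (2 * (1 + q ^ 2)) := by
        gcongr
        linarith [sq_nonneg (q - 1), add_sq 1 q, sub_sq q 1]
    _ = 2 * δ * (2 * C + δ) * (1 + q ^ 2) := by ring

theorem trace_smoothedPeriodogram (N B : ℕ) (x : ℤ → Fin K → ℂ) (ν : ℝ) :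
    (smoothedPeriodogram N B x ν).trace =
      ((((B : ℝ) + 1)⁻¹ * ∑ b ∈ Finset.Icc (-((B : ℤ) / 2)) ((B : ℤ) / 2),
        ‖WithLp.toLp 2 (finiteFourier N x (ν + (b : ℝ) / N))‖ ^ 2 : ℝ) : ℂ) := by
  have htrace (z : Fin K → ℂ) :
      (Matrix.vecMulVec z (star z)).trace = ((‖WithLp.toLp 2 z‖ ^ 2 : ℝ) : ℂ) := by
    rw [Matrix.trace_vecMulVec, ← EuclideanSpace.inner_toLp_toLp, inner_self_eq_norm_sq_to_K]
    simp
  rw [smoothedPeriodogram, Matrix.trace_smul, Matrix.trace_sum]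
  simp_rw [htrace]
  push_cast
  rw [one_div, smul_eq_mul]

theorem average_norm_finiteFourier_sq_le (N B : ℕ) (x : ℤ → Fin K → ℂ) (ν : ℝ) :
    ((B : ℝ) + 1)⁻¹ * ∑ b ∈ Finset.Icc (-((B : ℤ) / 2)) ((B : ℤ) / 2),
      ‖WithLp.toLp 2 (finiteFourier N x (ν + (b : ℝ) / N))‖ ^ 2 ≤
      K * (1 + ‖smoothedPeriodogram N B x ν - 1‖) := by
  set S := smoothedPeriodogram N B x ν with hS
  calc ((B : ℝ) + 1)⁻¹ * ∑ b ∈ Finset.Icc (-((B : ℤ) / 2)) ((B : ℤ) / 2),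
        ‖WithLp.toLp 2 (finiteFourier N x (ν + (b : ℝ) / N))‖ ^ 2
      = ‖S.trace‖ := by
        rw [hS, trace_smoothedPeriodogram, Complex.norm_of_nonneg (by positivity)]
    _ = ‖(1 : Matrix (Fin K) (Fin K) ℂ).trace + (S - 1).trace‖ := by
        rw [← Matrix.trace_add, add_sub_cancel]
    _ ≤ K + K * ‖S - 1‖ := by
        refine norm_add_le_of_le ?_ (norm_trace_le _)
        simp
    _ = K * (1 + ‖S - 1‖) := by ring

theorem smoothedPeriodogram_sub_conj (A : Matrix (Fin M) (Fin K) ℂ) (N B : ℕ)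
    (x : ℤ → Fin K → ℂ) (y : ℤ → Fin M → ℂ) (ν : ℝ) :
    smoothedPeriodogram N B y ν - A * smoothedPeriodogram N B x ν * Aᴴ =
      (1 / ((B : ℂ) + 1)) • ∑ b ∈ Finset.Icc (-((B : ℤ) / 2)) ((B : ℤ) / 2),
        (Matrix.vecMulVec (finiteFourier N y (ν + (b : ℝ) / N))
            (star (finiteFourier N y (ν + (b : ℝ) / N))) -
          A * Matrix.vecMulVec (finiteFourier N x (ν + (b : ℝ) / N))
            (star (finiteFourier N x (ν + (b : ℝ) / N))) * Aᴴ) := by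
  rw [smoothedPeriodogram, smoothedPeriodogram, Matrix.mul_smul, Matrix.smul_mul, ← smul_sub,
    Matrix.mul_sum, Matrix.sum_mul, ← Finset.sum_sub_distrib]

theorem norm_smoothedPeriodogram_sub_conj_le {A : Matrix (Fin M) (Fin K) ℂ} {N B : ℕ}
    (hB : Even B) {x : ℤ → Fin K → ℂ} {y : ℤ → Fin M → ℂ} {ν C δ : ℝ} (hA : ‖A‖ ≤ C) (hδ : 0 ≤ δ)
    (h : ∀ b ∈ Finset.Icc (-((B : ℤ) / 2)) ((B : ℤ) / 2),
      ‖WithLp.toLp 2 (finiteFourier N y (ν + (b : ℝ) / N) -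
        A *ᵥ finiteFourier N x (ν + (b : ℝ) / N))‖ ≤
      δ * (1 + ‖WithLp.toLp 2 (finiteFourier N x (ν + (b : ℝ) / N))‖)) :
    ‖smoothedPeriodogram N B y ν - A * smoothedPeriodogram N B x ν * Aᴴ‖ ≤
      2 * δ * (2 * C + δ) * (1 + K * (1 + ‖smoothedPeriodogram N B x ν - 1‖)) := by
  have hC : 0 ≤ C := (norm_nonneg _).trans hA
  have hcast : ‖1 / ((B : ℂ) + 1)‖ = ((B : ℝ) + 1)⁻¹ := by
    rw [one_div, norm_inv, ← Nat.cast_add_one, Complex.norm_natCast, Nat.cast_add_one]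
  have hone : ((B : ℝ) + 1)⁻¹ * ∑ _b ∈ Finset.Icc (-((B : ℤ) / 2)) ((B : ℤ) / 2), (1 : ℝ) = 1 := by
    rw [Finset.sum_const, card_Icc_neg_half_half hB, nsmul_one, Nat.cast_add_one]
    exact inv_mul_cancel₀ (by positivity)
  rw [smoothedPeriodogram_sub_conj, norm_smul, hcast]
  calc _ ≤ ((B : ℝ) + 1)⁻¹ * ∑ b ∈ Finset.Icc (-((B : ℤ) / 2)) ((B : ℤ) / 2),
        2 * δ * (2 * C + δ) *
          (1 + ‖WithLp.toLp 2 (finiteFourier N x (ν + (b : ℝ) / N))‖ ^ 2) := by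
        gcongr
        exact norm_sum_le_of_le _ fun b hb => norm_vecMulVec_sub_conj_le hA hδ (h b hb)
    _ = 2 * δ * (2 * C + δ) * (1 + ((B : ℝ) + 1)⁻¹ *
        ∑ b ∈ Finset.Icc (-((B : ℤ) / 2)) ((B : ℤ) / 2),
          ‖WithLp.toLp 2 (finiteFourier N x (ν + (b : ℝ) / N))‖ ^ 2) := by
        rw [← Finset.mul_sum, mul_left_comm, Finset.sum_add_distrib, mul_add _ _ (∑ b ∈ _, _), hone]
    _ ≤ _ := by
        gcongr _ * (1 + ?_)
        exact average_norm_finiteFourier_sq_le N B x ν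

theorem norm_smoothedPeriodogram_sub_mul_conjTranspose_le {A : Matrix (Fin M) (Fin K) ℂ} {N B : ℕ}
    (hB : Even B) {x : ℤ → Fin K → ℂ} {y : ℤ → Fin M → ℂ} {ν C δ : ℝ} (hA : ‖A‖ ≤ C) (hδ : 0 ≤ δ)
    (h : ∀ b ∈ Finset.Icc (-((B : ℤ) / 2)) ((B : ℤ) / 2),
      ‖WithLp.toLp 2 (finiteFourier N y (ν + (b : ℝ) / N) -
        A *ᵥ finiteFourier N x (ν + (b : ℝ) / N))‖ ≤
      δ * (1 + ‖WithLp.toLp 2 (finiteFourier N x (ν + (b : ℝ) / N))‖)) :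
    ‖smoothedPeriodogram N B y ν - A * Aᴴ‖ ≤
      2 * δ * (2 * C + δ) * (1 + K * (1 + ‖smoothedPeriodogram N B x ν - 1‖)) +
        C ^ 2 * ‖smoothedPeriodogram N B x ν - 1‖ := by
  set S := smoothedPeriodogram N B x ν
  have hsplit : smoothedPeriodogram N B y ν - A * Aᴴ =
      (smoothedPeriodogram N B y ν - A * S * Aᴴ) + A * (S - 1) * Aᴴ := by
    rw [Matrix.mul_sub, Matrix.sub_mul, Matrix.mul_one]
    abel
  rw [hsplit]
  refine norm_add_le_of_le (norm_smoothedPeriodogram_sub_conj_le hB hA hδ h) ?_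
  calc ‖A * (S - 1) * Aᴴ‖ ≤ ‖A‖ * ‖S - 1‖ * ‖Aᴴ‖ :=
        (Matrix.l2_opNorm_mul _ _).trans (by gcongr; exact Matrix.l2_opNorm_mul _ _)
    _ ≤ C * ‖S - 1‖ * C := by
        rw [Matrix.l2_opNorm_conjTranspose]
        have hC : 0 ≤ C := (norm_nonneg _).trans hA
        gcongr
    _ = C ^ 2 * ‖S - 1‖ := by ring

end Perturbation

section UniformConsistency

theorem norm_finiteFourier_sub_transferFunction_mulVec_le {M K N B : ℕ}
    {H : ℤ → Matrix (Fin M) (Fin K) ℂ} {x : ℤ → Fin K → ℂ} {y : ℤ → Fin M → ℂ} {C r : ℝ}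
    (hH : Summable fun k : ℤ => (1 + |(k : ℝ)|) * ‖H k‖)
    (hC : ∑' k : ℤ, (1 + |(k : ℝ)|) * ‖H k‖ ≤ C)
    (hr : ∀ ν : ℝ, ‖WithLp.toLp 2 (finiteFourier N y ν -
      transferFunction H ν *ᵥ finiteFourier N x ν)‖ ≤ r)
    (ν : ℝ) {b : ℤ} (hb : b ∈ Finset.Icc (-((B : ℤ) / 2)) ((B : ℤ) / 2)) :
    ‖WithLp.toLp 2 (finiteFourier N y (ν + (b : ℝ) / N) -
        transferFunction H ν *ᵥ finiteFourier N x (ν + (b : ℝ) / N))‖ ≤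
      (r + 2 * Real.pi * ((B : ℝ) / N) * C) *
        (1 + ‖WithLp.toLp 2 (finiteFourier N x (ν + (b : ℝ) / N))‖) := by
  set ν' := ν + (b : ℝ) / N with hν'
  set z := finiteFourier N x ν'
  have hr0 : 0 ≤ r := (norm_nonneg _).trans (hr 0)
  have hC0 : 0 ≤ C := (tsum_nonneg fun k => by positivity).trans hC
  have hshift : |ν' - ν| ≤ (B : ℝ) / N := by
    have hbB : |b| ≤ (B : ℤ) := by
      rw [Finset.mem_Icc] at hb
      rw [abs_le]
      omega
    rw [hν', add_sub_cancel_left, abs_div, Nat.abs_cast]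
    gcongr
    exact_mod_cast hbB
  have hlip : ‖transferFunction H ν' - transferFunction H ν‖ ≤ 2 * Real.pi * ((B : ℝ) / N) * C :=
    (norm_transferFunction_sub_le hH ν' ν).trans (by gcongr)
  have hsplit : finiteFourier N y ν' - transferFunction H ν *ᵥ z =
      (finiteFourier N y ν' - transferFunction H ν' *ᵥ z) +
        (transferFunction H ν' - transferFunction H ν) *ᵥ z := by
    rw [Matrix.sub_mulVec]
    abel
  calc ‖WithLp.toLp 2 (finiteFourier N y ν' - transferFunction H ν *ᵥ z)‖
      ≤ r + 2 * Real.pi * ((B : ℝ) / N) * C * ‖WithLp.toLp 2 z‖ := by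
        rw [hsplit, WithLp.toLp_add]
        exact norm_add_le_of_le (hr ν') ((Matrix.l2_opNorm_mulVec _ (WithLp.toLp 2 z)).trans
          (by gcongr))
    _ ≤ r * (1 + ‖WithLp.toLp 2 z‖) +
          2 * Real.pi * ((B : ℝ) / N) * C * (1 + ‖WithLp.toLp 2 z‖) := by
        gcongr
        · exact le_mul_of_one_le_right hr0 (le_add_of_nonneg_right (norm_nonneg _))
        · exact le_add_of_nonneg_left zero_le_one
    _ = _ := by ring

variable {Ω : Type*} [MeasurableSpace Ω] {μ : Measure Ω} {K : ℕ} {d N B : ℕ → ℕ}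
  {H : (M : ℕ) → ℤ → Matrix (Fin (d M)) (Fin K) ℂ} {ε : ℕ → ℤ → Ω → Fin K → ℂ}

theorem ae_tendsto_iSup_norm_smoothedPeriodogram_sub [IsFiniteMeasure μ] (h : SmoothingRegime N B)
    (hH : ∃ C : ℝ, ∀ M, 1 ≤ M → Summable (fun k : ℤ => (1 + |(k : ℝ)|) * ‖H M k‖) ∧
      ∑' k : ℤ, (1 + |(k : ℝ)|) * ‖H M k‖ ≤ C)
    (hε : ∀ M, 1 ≤ M → IsComplexGaussianWhiteNoise (ε M) μ)
    {u : (M : ℕ) → ℤ → Ω → Fin (d M) → ℂ}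
    (hu : ∀ M, 1 ≤ M → IsFilterOutput (H M) (ε M) (u M) μ) :
    ∀ᵐ ω ∂μ, Tendsto (fun M : ℕ => ⨆ k : Fin (N M),
      ‖smoothedPeriodogram (N M) (B M) (fun n => u M n ω) ((k : ℝ) / (N M : ℝ)) -
        transferFunction (H M) ((k : ℝ) / (N M : ℝ)) *
          (transferFunction (H M) ((k : ℝ) / (N M : ℝ)))ᴴ‖) atTop (𝓝 0) := by
  obtain ⟨C, hC⟩ := hH
  filter_upwards [ae_tendsto_smoothedPeriodogram_sub_one h hε,
    ae_exists_tendsto_finiteFourier_sub_le h.summable_inv_sampleSize hC hε hu]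
    with ω hone ⟨r, hr, hr'⟩
  set F := uniformAtTop fun M => Fin (N M)
  set δ : ℕ → ℝ := fun M => r M + 2 * Real.pi * ((B M : ℝ) / N M) * C with hδ
  have hδ0 : Tendsto (fun p : Σ M, Fin (N M) => δ p.1) F (𝓝 0) := by
    refine tendsto_comp_fst_uniformAtTop ?_
    simpa using hr.add ((h.tendsto_span_div_sampleSize.const_mul (2 * Real.pi)).mul_const C)
  have hbound0 := ((((hδ0.const_mul 2).mul (hδ0.const_add (2 * C))).mul
    (((hone.norm.const_add 1).const_mul (K : ℝ)).const_add 1))).add (hone.norm.const_mul (C ^ 2))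
  simp only [mul_zero, zero_mul, norm_zero, add_zero] at hbound0
  refine tendsto_iSup_of_tendsto_uniformAtTop (ι := fun M => Fin (N M)) (f := fun p =>
    ‖smoothedPeriodogram (N p.1) (B p.1) (fun n => u p.1 n ω) ((p.2 : ℝ) / (N p.1 : ℝ)) -
        transferFunction (H p.1) ((p.2 : ℝ) / (N p.1 : ℝ)) *
          (transferFunction (H p.1) ((p.2 : ℝ) / (N p.1 : ℝ)))ᴴ‖) (fun _ => norm_nonneg _) ?_
  refine squeeze_zero' (Eventually.of_forall fun _ => norm_nonneg _) ?_ hbound0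
  filter_upwards [tendsto_comap.eventually (hr'.and (eventually_ge_atTop 1))]
    with ⟨M, k⟩ ⟨hM, hM1⟩
  obtain ⟨hsum, hle⟩ := hC M hM1
  refine norm_smoothedPeriodogram_sub_mul_conjTranspose_le (h.even_span M hM1)
    ((norm_transferFunction_le hsum _).trans hle) ?_ fun b hb =>
      norm_finiteFourier_sub_transferFunction_mulVec_le hsum hle hM _ hb
  have hr0 : 0 ≤ r M := (norm_nonneg _).trans (hM 0)
  have hC0 : 0 ≤ C := (tsum_nonneg fun k => by positivity).trans hle
  simp only [hδ]
  positivity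

end UniformConsistency

section MatrixSeries

variable {l m n : ℕ} {ι κ : Type*}

theorem hasSum_matrix_mul_of_summable_norm {A : ι → Matrix (Fin l) (Fin m) ℂ}
    {D : κ → Matrix (Fin m) (Fin n) ℂ} {a : Matrix (Fin l) (Fin m) ℂ}
    {d : Matrix (Fin m) (Fin n) ℂ} (hA : HasSum A a) (hD : HasSum D d)
    (hA' : Summable fun i => ‖A i‖) (hD' : Summable fun j => ‖D j‖) :
    HasSum (fun p : ι × κ => A p.1 * D p.2) (a * d) := by
  have hsum : Summable fun p : ι × κ => A p.1 * D p.2 :=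
    Summable.of_norm_bounded
      (hA'.mul_of_nonneg hD' (fun _ => norm_nonneg _) fun _ => norm_nonneg _)
      fun p => Matrix.l2_opNorm_mul (A p.1) (D p.2)
  have hfiber : HasSum (fun i => A i * d) (∑' p : ι × κ, A p.1 * D p.2) :=
    hsum.hasSum.prod_fiberwise fun i =>
      hD.map (AddMonoidHom.mk' (fun X => A i * X) (Matrix.mul_add _))
        (continuous_const.matrix_mul continuous_id)
  have hleft : HasSum (fun i => A i * d) (a * d) :=
    hA.map (AddMonoidHom.mk' (fun X => X * d) (fun X Y => Matrix.add_mul X Y d))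
      (continuous_id.matrix_mul continuous_const)
  rw [hleft.unique hfiber]
  exact hsum.hasSum

end MatrixSeries

section SpectralDensity

variable {M K : ℕ} {H : ℤ → Matrix (Fin M) (Fin K) ℂ}

/-- The autocovariance at lag `ℓ` of the output of the filter `(H_k)` driven by a unit white
noise. -/
noncomputable def filterAutocovariance (H : ℤ → Matrix (Fin M) (Fin K) ℂ) (ℓ : ℤ) :
    Matrix (Fin M) (Fin M) ℂ :=
  ∑' k : ℤ, H k * (H (k - ℓ))ᴴ

theorem hasSum_filterAutocovariance (hH : Summable fun k => ‖H k‖) (ℓ : ℤ) :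
    HasSum (fun k : ℤ => H k * (H (k - ℓ))ᴴ) (filterAutocovariance H ℓ) := by
  refine (Summable.of_norm_bounded (g := fun k => ‖H k‖ * ‖H (k - ℓ)‖) ?_ fun k => ?_).hasSum
  · exact (hH.mul_of_nonneg hH (fun _ => norm_nonneg _) fun _ => norm_nonneg _).comp_injective
      (i := fun k : ℤ => (k, k - ℓ)) fun _ _ hk => (Prod.ext_iff.1 hk).1
  · exact (Matrix.l2_opNorm_mul _ _).trans_eq (by rw [Matrix.l2_opNorm_conjTranspose])

theorem exp_neg_two_pi_mul_star_sub (ν : ℝ) (k ℓ : ℤ) :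
    Complex.exp (-(2 * (Real.pi : ℂ) * Complex.I * (ν : ℂ) * (k : ℂ))) *
      star (Complex.exp (-(2 * (Real.pi : ℂ) * Complex.I * (ν : ℂ) * ((k - ℓ : ℤ) : ℂ)))) =
      Complex.exp (-(2 * (Real.pi : ℂ) * Complex.I * (ν : ℂ) * (ℓ : ℂ))) := by
  rw [Complex.star_def, ← Complex.exp_conj, ← Complex.exp_add]
  congr 1
  simp only [map_neg, map_mul, Complex.conj_I, Complex.conj_ofReal, map_ofNat, map_intCast]
  push_cast
  ring

theorem hasSum_exp_smul_filterAutocovariance (hH : Summable fun k => ‖H k‖) (ν : ℝ) :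
    HasSum (fun ℓ : ℤ => Complex.exp (-(2 * (Real.pi : ℂ) * Complex.I * (ν : ℂ) * (ℓ : ℂ))) •
      filterAutocovariance H ℓ) (transferFunction H ν * (transferFunction H ν)ᴴ) := by
  set e : ℤ → ℂ := fun k => Complex.exp (-(2 * (Real.pi : ℂ) * Complex.I * (ν : ℂ) * (k : ℂ)))
  have hterm : Summable fun k => ‖e k • H k‖ :=
    hH.congr fun k => by rw [norm_smul, norm_exp_neg_two_pi_mul, one_mul]
  have htransfer : HasSum (fun k => e k • H k) (transferFunction H ν) :=
    hasSum_transferFunction hH ν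
  have hprod := hasSum_matrix_mul_of_summable_norm htransfer htransfer.matrix_conjTranspose hterm
    (by simpa only [Matrix.l2_opNorm_conjTranspose] using hterm)
  let lagEquiv : ℤ × ℤ ≃ ℤ × ℤ :=
    { toFun := fun p => (p.2, p.2 - p.1)
      invFun := fun p => (p.1 - p.2, p.1)
      left_inv := fun p => by simp
      right_inv := fun p => by simp }
  refine (lagEquiv.hasSum_iff.2 hprod).prod_fiberwise fun ℓ => ?_
  refine ((hasSum_filterAutocovariance hH ℓ).const_smul (e ℓ)).congr_fun fun k => ?_
  simp only [lagEquiv, Function.comp_apply, Equiv.coe_fn_mk]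
  rw [Matrix.conjTranspose_smul, Matrix.smul_mul, Matrix.mul_smul, smul_smul,
    exp_neg_two_pi_mul_star_sub]

theorem summable_norm_filterCoefficient (hH : Summable fun k => ‖H k‖) (n : ℤ) (i : Fin M) :
    Summable fun p : ℤ × Fin K => ‖H (n - p.1) i p.2‖ := by
  have hprod : Summable fun p : ℤ × Fin K => ‖H (n - p.1)‖ * (1 : ℝ) :=
    Summable.mul_of_nonneg (f := fun m : ℤ => ‖H (n - m)‖) (g := fun _ : Fin K => (1 : ℝ))
      ((Equiv.subLeft n).summable_iff (f := fun k => ‖H k‖) |>.2 hH) Summable.of_finite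
      (fun _ => norm_nonneg _) fun _ => zero_le_one
  refine hprod.of_nonneg_of_le (fun _ => norm_nonneg _) fun p => ?_
  rw [mul_one]
  exact norm_apply_le_l2_opNorm _ _ _

variable {Ω : Type*} [MeasurableSpace Ω] {μ : Measure Ω} [IsProbabilityMeasure μ]
  {ε : ℤ → Ω → Fin K → ℂ} {u : ℤ → Ω → Fin M → ℂ}

theorem IsFilterOutput.ae_hasSum_apply (hu : IsFilterOutput H ε u μ)
    (hε : IsWhiteFamily (fun (p : ℤ × Fin K) ω => ε p.1 ω p.2) μ)
    (hH : Summable fun k => ‖H k‖) (n : ℤ) (i : Fin M) :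
    ∀ᵐ ω ∂μ, HasSum (fun p : ℤ × Fin K => H (n - p.1) i p.2 * ε p.1 ω p.2) (u n ω i) := by
  filter_upwards [hu n, hε.ae_summable_norm_mul (summable_norm_filterCoefficient hH n i)]
    with ω hω hsum
  have hinput : HasSum (fun m : ℤ => (H (n - m) *ᵥ ε m ω) i) (u n ω i) := by
    have hshift := (Equiv.subLeft n).hasSum_iff.2 (Pi.hasSum.1 hω i)
    simpa [Function.comp_def] using hshift
  have hfiber := hsum.of_norm.hasSum.prod_fiberwise fun m => hasSum_fintype _
  rw [hinput.unique hfiber]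
  exact hsum.of_norm.hasSum

theorem IsFilterOutput.integral_mul_star_eq (hu : IsFilterOutput H ε u μ)
    (hε : IsWhiteFamily (fun (p : ℤ × Fin K) ω => ε p.1 ω p.2) μ)
    (hH : Summable fun k => ‖H k‖) (n ℓ : ℤ) (i j : Fin M) :
    ∫ ω, u n ω i * star (u (n - ℓ) ω j) ∂μ = filterAutocovariance H ℓ i j := by
  have hfiber := (hε.hasSum_integral_mul_star (summable_norm_filterCoefficient hH n i)
    (summable_norm_filterCoefficient hH (n - ℓ) j) (hu.ae_hasSum_apply hε hH n i)
    (hu.ae_hasSum_apply hε hH (n - ℓ) j)).prod_fiberwise fun m => hasSum_fintype _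
  have hcov := (Equiv.subLeft n).hasSum_iff.2
    (Pi.hasSum.1 (Pi.hasSum.1 (hasSum_filterAutocovariance hH ℓ) i) j)
  refine hfiber.unique (hcov.congr_fun fun m => ?_)
  simp [Matrix.mul_apply, sub_right_comm n m ℓ]

theorem IsFilterOutput.hasSpectralDensity (hu : IsFilterOutput H ε u μ)
    (hε : IsWhiteFamily (fun (p : ℤ × Fin K) ω => ε p.1 ω p.2) μ)
    (hH : Summable fun k => ‖H k‖) :
    HasSpectralDensity u (fun ν => transferFunction H ν * (transferFunction H ν)ᴴ) μ := by
  have hcoeff := summable_norm_filterCoefficient hH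
  have hu' := hu.ae_hasSum_apply hε hH
  exact ⟨fun n i => ⟨hε.integrable_of_ae_hasSum (hcoeff n i) (hu' n i),
      hε.integral_eq_zero_of_ae_hasSum (hcoeff n i) (hu' n i)⟩,
    filterAutocovariance H,
    fun n ℓ i j => ⟨hε.integrable_mul_star_of_ae_hasSum (hcoeff n i) (hcoeff (n - ℓ) j) (hu' n i)
      (hu' (n - ℓ) j), hu.integral_mul_star_eq hε hH n ℓ i j⟩,
    hasSum_exp_smul_filterAutocovariance hH⟩

end SpectralDensity

theorem mainTheorem7_general {Ω : Type*} [MeasurableSpace Ω] (μ : Measure Ω)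
    [IsProbabilityMeasure μ] {K : ℕ} {d N B : ℕ → ℕ} (hregime : SmoothingRegime N B)
    {H : (M : ℕ) → ℤ → Matrix (Fin (d M)) (Fin K) ℂ}
    (hH : ∃ C : ℝ, ∀ M, 1 ≤ M → Summable (fun k : ℤ => (1 + |(k : ℝ)|) * ‖H M k‖) ∧
      ∑' k : ℤ, (1 + |(k : ℝ)|) * ‖H M k‖ ≤ C)
    {ε : ℕ → ℤ → Ω → Fin K → ℂ} (hε : ∀ M, 1 ≤ M → IsComplexGaussianWhiteNoise (ε M) μ)
    {u : (M : ℕ) → ℤ → Ω → Fin (d M) → ℂ}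
    (hu : ∀ M, 1 ≤ M → IsFilterOutput (H M) (ε M) (u M) μ) :
    (∀ M, 1 ≤ M →
      HasSpectralDensity (u M)
        (fun ν => transferFunction (H M) ν * (transferFunction (H M) ν)ᴴ) μ ∧
      ∀ ν : ℝ, (transferFunction (H M) ν * (transferFunction (H M) ν)ᴴ).rank ≤ K) ∧
    ∀ᵐ ω ∂μ, Tendsto (fun M : ℕ => ⨆ k : Fin (N M),
      ‖smoothedPeriodogram (N M) (B M) (fun n => u M n ω) ((k : ℝ) / (N M : ℝ)) -
        transferFunction (H M) ((k : ℝ) / (N M : ℝ)) *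
          (transferFunction (H M) ((k : ℝ) / (N M : ℝ)))ᴴ‖) atTop (𝓝 0) := by
  refine ⟨fun M hM => ⟨?_, fun ν => ?_⟩,
    ae_tendsto_iSup_norm_smoothedPeriodogram_sub hregime hH hε hu⟩
  · obtain ⟨C, hC⟩ := hH
    exact (hu M hM).hasSpectralDensity (hε M hM).isWhiteFamily
      (summable_norm_of_summable_memory (hC M hM).1)
  · exact (Matrix.rank_mul_le_left _ _).trans (Matrix.rank_le_width _)

theorem mainTheorem7 {Ω : Type*} [MeasurableSpace Ω] (μ : Measure Ω) [IsProbabilityMeasure μ]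
    (K : ℕ) (N B : ℕ → ℕ) (hregime : HighDimRegime N B)
    (H : (M : ℕ) → ℤ → Matrix (Fin M) (Fin K) ℂ) (hH : FilterAssumption H)
    (ε : ℕ → ℤ → Ω → Fin K → ℂ)
    (hε : ∀ M : ℕ, 1 ≤ M → IsComplexGaussianWhiteNoise (ε M) μ)
    (u : (M : ℕ) → ℤ → Ω → Fin M → ℂ)
    (hu : ∀ M : ℕ, 1 ≤ M → IsFilterOutput (H M) (ε M) (u M) μ) :
    (∀ M : ℕ, 1 ≤ M →
      HasSpectralDensity (u M)
        (fun ν => transferFunction (H M) ν * (transferFunction (H M) ν)ᴴ) μ ∧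
      ∀ ν : ℝ, (transferFunction (H M) ν * (transferFunction (H M) ν)ᴴ).rank ≤ K) ∧
    ∀ᵐ ω ∂μ, Tendsto (fun M : ℕ => ⨆ k : Fin (N M),
      ‖smoothedPeriodogram (N M) (B M) (fun n => u M n ω) ((k : ℝ) / (N M : ℝ)) -
        transferFunction (H M) ((k : ℝ) / (N M : ℝ)) *
          (transferFunction (H M) ((k : ℝ) / (N M : ℝ)))ᴴ‖) atTop (𝓝 0) := by
  exact mainTheorem7_general μ hregime.smoothingRegime hH.memory hε hu
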